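/- All graphs are finite and simple. Let $G$ be a graph. A set $M\subseteq E(G)$ is an \emph{induced matching} if no two distinct edges of $M$ share an endvertex and no edge of $G$ joins an endvertex of one to an endvertex of the other; $\nu_I(G)$ is the maximum cardinality of an induced matching of $G$. A set $B\subseteq E(G)$ is an \emph{edge open packing set} if for any two distinct edges $e_1,e_2\in B$ there is no edge $e\in E(G)\setminus\{e_1,e_2\}$ joining an endvertex of $e_1$ to an endvertex of $e_2$ (the edges $e_1,e_2$ themselves may share an endvertex); $\rho_e^o(G)$ is the maximum cardinality of an edge open packing set of $G$. For $k\ge 1$, the \emph{spider} $S^k$ with $k$ legs is the tree obtained from the star $K_{1,k}$ with center $v$ by subdividing each of its edges exactly once; $v$ is called the center of $S^k$. Let $\mathcal F$ be the family of all trees $T$ that can be obtained, for some $n\ge 1$ and some $k_1,\dots,k_n\ge 2$, from the disjoint union of spiders $S_1=S^{k_1},\dots,S_n=S^{k_n}$ with centers $v_1,\dots,v_n$ by adding $n-1$ edges $e_1,\dots,e_{n-1}$ such that 1. for every $i\in\{1,\dots,n-1\}$, the edge $e_i$ has an endvertex in $\{v_1,\dots,v_n\}$; 2. for every $i\in\{1,\dots,n\}$,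 at least two leaves of $S_i$ have degree $1$ in $T$. Let $P_m$ denote the path on $m$ vertices. **Theorem.** For every tree $T$, $\rho_e^o(T)=\nu_I(T)$ if and only if $T\in\mathcal F$ or $T$ is isomorphic to $P_1$ or $P_2$. -/

import Mathlib

/-- `B` is an edge open packing set of `G`: a set of edges of `G` such that no two distinct edges
`e₁, e₂` of `B` have a common edge, that is, an edge of `G` other than `e₁` and `e₂` that joins an
endvertex of `e₁` to an endvertex of `e₂`. -/
def SimpleGraph.IsEdgeOpenPacking {V : Type*} (G : SimpleGraph V) (B : Finset (Sym2 V)) : Prop :=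
  (∀ e ∈ B, e ∈ G.edgeSet) ∧
    ∀ e₁ ∈ B, ∀ e₂ ∈ B, e₁ ≠ e₂ →
      ¬ ∃ e ∈ G.edgeSet, e ≠ e₁ ∧ e ≠ e₂ ∧ ∃ a ∈ e₁, ∃ b ∈ e₂, e = s(a, b)

/-- `M` is an induced matching of `G`: a set of edges of `G` such that two distinct edges of `M`
never share an endvertex and are never joined by an edge of `G`. -/
def SimpleGraph.IsInducedMatching {V : Type*} (G : SimpleGraph V) (M : Finset (Sym2 V)) : Prop :=
  (∀ e ∈ M, e ∈ G.edgeSet) ∧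
    ∀ e₁ ∈ M, ∀ e₂ ∈ M, e₁ ≠ e₂ → ∀ a ∈ e₁, ∀ b ∈ e₂, a ≠ b ∧ ¬ G.Adj a b

/-- The edge open packing number: the maximum cardinality of an edge open packing set
(the maximum exists when the vertex set is finite). -/
noncomputable def SimpleGraph.edgeOpenPackingNumber {V : Type*} (G : SimpleGraph V) : ℕ :=
  sSup {m : ℕ | ∃ B : Finset (Sym2 V), G.IsEdgeOpenPacking B ∧ B.card = m}

/-- The induced matching number: the maximum cardinality of an induced matching
(the maximum exists when the vertex set is finite). -/
noncomputable def SimpleGraph.inducedMatchingNumber {V : Type*} (G : SimpleGraph V) : ℕ :=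
  sSup {m : ℕ | ∃ M : Finset (Sym2 V), G.IsInducedMatching M ∧ M.card = m}

/-- The vertices of the spider with `k` legs: its center, and on each leg `j` the neighbour
`mid j` of the center followed by the end `leaf j` of the leg. -/
inductive SpiderVertex (k : ℕ) : Type
  | center : SpiderVertex k
  | mid (j : Fin k) : SpiderVertex k
  | leaf (j : Fin k) : SpiderVertex k

/-- The spider with `k` legs: the star with `k` edges, each of them subdivided exactly once. -/
def spider (k : ℕ) : SimpleGraph (SpiderVertex k) :=
  SimpleGraph.fromRel fun x y =>
    ∃ j : Fin k, (x = .center ∧ y = .mid j) ∨ (x = .mid j ∧ y = .leaf j)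

/-- The disjoint union of the spiders with `k 0, …, k (n - 1)` legs. -/
def spiderUnion {n : ℕ} (k : Fin n → ℕ) : SimpleGraph (Σ i : Fin n, SpiderVertex (k i)) :=
  SimpleGraph.fromRel fun x y =>
    ∃ (i : Fin n) (a b : SpiderVertex (k i)), (spider (k i)).Adj a b ∧ x = ⟨i, a⟩ ∧ y = ⟨i, b⟩

/-- `T` belongs to the family `F`: up to isomorphism, `T` is a tree obtained from a disjoint union
of `n` spiders, each with at least two legs, by adding a set `E` of `n - 1` new edges such that
every edge of `E` has the center of some spider as an endvertex, and every spider has at least two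
leaves (of the spider) whose degree in the resulting tree is `1`. -/
def SimpleGraph.IsInSpiderFamily {V : Type*} (T : SimpleGraph V) : Prop :=
  ∃ (n : ℕ) (k : Fin n → ℕ) (E : Finset (Sym2 (Σ i : Fin n, SpiderVertex (k i))))
    (H : SimpleGraph (Σ i : Fin n, SpiderVertex (k i))),
    (∀ i, 2 ≤ k i) ∧
    (∀ e ∈ E, ¬ e.IsDiag ∧ e ∉ (spiderUnion k).edgeSet) ∧
    E.card + 1 = n ∧
    H = spiderUnion k ⊔ SimpleGraph.fromEdgeSet (E : Set (Sym2 (Σ i : Fin n, SpiderVertex (k i)))) ∧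
    H.IsTree ∧
    (∀ e ∈ E, ∃ i : Fin n, (⟨i, .center⟩ : Σ i : Fin n, SpiderVertex (k i)) ∈ e) ∧
    (∀ i : Fin n, ∃ j₁ j₂ : Fin (k i), j₁ ≠ j₂ ∧
      (H.neighborSet ⟨i, .leaf j₁⟩).ncard = 1 ∧ (H.neighborSet ⟨i, .leaf j₂⟩).ncard = 1) ∧
    Nonempty (T ≃g H)

/-! An induced matching is an edge open packing, so equality means that no packing beats the best
induced matching.

Sufficiency. Every edge of an edge open packing has an end lying on no other edge of the packing,
and these outer ends are independent (`IsEdgeOpenPacking.exists_outer`). In a tree of the family the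
two vertices of a leg are adjacent, so at most one is an outer end; and if a center is an outer end,
one of its pendant legs carries none and can be charged instead. Hence a packing has at most as many
edges as there are legs (`edgeOpenPackingNumber_le_sum`), a number attained by the induced matching
of all mid-leaf edges.

Necessity. Let S be the vertex set of a maximum induced matching. If S contains every vertex,
connectedness leaves only one edge. Otherwise call m ∈ S a pendant of c ∉ S if m is a neighbour of c
and its partner is a leaf of the tree. Once the vertices outside S own pairwise disjoint pairs of
pendants, they serve as centers and the matching edges as legs
(`IsTree.isInSpiderFamily_of_pendants`). Such pairs come from Hall's theorem. In a minimal violator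
A with pendant set N, counting tree edges shows that A ∪ N spans a subtree and that each c ∈ A has a
private pendant p c. Then A can be traded for a larger packing
(`IsRooting.card_lowerEnds_lt_of_deficient`): add the edges joining c to p c, drop the matching
edges at the remaining |N| - |A| < |A| pendants, and reroute the matching edges that get in the way.
-/

namespace SimpleGraph

variable {V : Type*} {G : SimpleGraph V}

/-! ### Edge open packings as families of stars -/

lemma isEdgeOpenPacking_iff {B : Finset (Sym2 V)} :
    G.IsEdgeOpenPacking B ↔ (∀ e ∈ B, e ∈ G.edgeSet) ∧
      ∀ e₁ ∈ B, ∀ e₂ ∈ B, e₁ ≠ e₂ → ∀ a ∈ e₁, ∀ b ∈ e₂, G.Adj a b →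
        s(a, b) = e₁ ∨ s(a, b) = e₂ := by
  refine and_congr_right fun _ => forall₅_congr fun e₁ _ e₂ _ _ => ?_
  constructor
  · intro h a ha b hb hab
    by_contra! hne
    exact h ⟨s(a, b), hab, hne.1, hne.2, a, ha, b, hb, rfl⟩
  · rintro h ⟨e, he, h₁, h₂, a, ha, b, hb, rfl⟩
    rcases h a ha b hb he with h | h
    · exact h₁ h
    · exact h₂ h

lemma IsInducedMatching.isEdgeOpenPacking {M : Finset (Sym2 V)} (hM : G.IsInducedMatching M) :
    G.IsEdgeOpenPacking M :=
  isEdgeOpenPacking_iff.2 ⟨hM.1, fun e₁ h₁ e₂ h₂ hne a ha b hb hab =>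
    ((hM.2 e₁ h₁ e₂ h₂ hne a ha b hb).2 hab).elim⟩

section Numbers

variable [Finite V]

lemma bddAbove_card_finset (P : Finset (Sym2 V) → Prop) :
    BddAbove {m : ℕ | ∃ B : Finset (Sym2 V), P B ∧ B.card = m} := by
  have := Fintype.ofFinite (Sym2 V)
  refine ⟨Fintype.card (Sym2 V), ?_⟩
  rintro m ⟨B, -, rfl⟩
  exact Finset.card_le_univ B

lemma IsEdgeOpenPacking.card_le {B : Finset (Sym2 V)} (hB : G.IsEdgeOpenPacking B) :
    B.card ≤ G.edgeOpenPackingNumber :=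
  le_csSup (bddAbove_card_finset _) ⟨B, hB, rfl⟩

lemma IsInducedMatching.card_le {M : Finset (Sym2 V)} (hM : G.IsInducedMatching M) :
    M.card ≤ G.inducedMatchingNumber :=
  le_csSup (bddAbove_card_finset _) ⟨M, hM, rfl⟩

variable (G) in
lemma exists_isEdgeOpenPacking_card_eq :
    ∃ B, G.IsEdgeOpenPacking B ∧ B.card = G.edgeOpenPackingNumber :=
  Nat.sSup_mem (s := {m : ℕ | ∃ B : Finset (Sym2 V), G.IsEdgeOpenPacking B ∧ B.card = m})
    ⟨0, ∅, ⟨by simp, by simp⟩, rfl⟩ (bddAbove_card_finset _)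

variable (G) in
lemma exists_isInducedMatching_card_eq :
    ∃ M, G.IsInducedMatching M ∧ M.card = G.inducedMatchingNumber :=
  Nat.sSup_mem (s := {m : ℕ | ∃ B : Finset (Sym2 V), G.IsInducedMatching B ∧ B.card = m})
    ⟨0, ∅, ⟨by simp, by simp⟩, rfl⟩ (bddAbove_card_finset _)

variable (G) in
lemma inducedMatchingNumber_le_edgeOpenPackingNumber :
    G.inducedMatchingNumber ≤ G.edgeOpenPackingNumber := by
  obtain ⟨M, hM, h⟩ := G.exists_isInducedMatching_card_eq
  exact h ▸ hM.isEdgeOpenPacking.card_le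

lemma edgeOpenPackingNumber_eq_of_subsingleton (h : G.edgeSet.Subsingleton) :
    G.edgeOpenPackingNumber = G.inducedMatchingNumber := by
  refine le_antisymm ?_ G.inducedMatchingNumber_le_edgeOpenPackingNumber
  obtain ⟨B, hB, h'⟩ := G.exists_isEdgeOpenPacking_card_eq
  rw [← h']
  exact IsInducedMatching.card_le
    ⟨hB.1, fun e₁ h₁ e₂ h₂ hne => (hne (h (hB.1 _ h₁) (hB.1 _ h₂))).elim⟩

/-- A family of edges `x i — κ i` whose outer ends `x i` are independent, grouped into stars
with centers `κ i`, forms an edge open packing set. -/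
lemma card_le_edgeOpenPackingNumber {ι : Type*} (I : Finset ι) (x κ : ι → V)
    (hadj : ∀ i ∈ I, G.Adj (x i) (κ i))
    (hx : ∀ i ∈ I, ∀ j ∈ I, i ≠ j → x i ≠ x j ∧ ¬ G.Adj (x i) (x j) ∧ ¬ G.Adj (κ i) (κ j) ∧
      (G.Adj (x i) (κ j) → κ i = κ j)) :
    I.card ≤ G.edgeOpenPackingNumber := by
  classical
  have hinj : Set.InjOn (fun i => s(x i, κ i)) (I : Set ι) := by
    intro i hi j hj hij
    by_contra hne
    obtain ⟨h₁, h₂, -, -⟩ := hx i hi j hj hne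
    rcases Sym2.eq_iff.1 hij with h | h
    · exact h₁ h.1
    · exact h₂ (h.2 ▸ hadj i hi)
  rw [← Finset.card_image_of_injOn hinj]
  refine IsEdgeOpenPacking.card_le (isEdgeOpenPacking_iff.2 ⟨?_, ?_⟩)
  · simp only [Finset.mem_image]
    rintro _ ⟨i, hi, rfl⟩
    exact hadj i hi
  · simp only [Finset.mem_image]
    rintro _ ⟨i, hi, rfl⟩ _ ⟨j, hj, rfl⟩ hne a ha b hb hab
    have hij : i ≠ j := by rintro rfl; exact hne rfl
    obtain ⟨h₁, h₂, h₃, h₄⟩ := hx i hi j hj hij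
    obtain ⟨-, -, -, h₅⟩ := hx j hj i hi hij.symm
    rcases Sym2.mem_iff.1 ha with rfl | rfl <;> rcases Sym2.mem_iff.1 hb with rfl | rfl
    · exact (h₂ hab).elim
    · left; rw [h₄ hab]
    · right; rw [← h₅ hab.symm, Sym2.eq_swap]
    · exact (h₃ hab).elim

end Numbers

/-- Each edge of an edge open packing set can be given an outer end, different edges having
different and nonadjacent outer ends; the outer end of an edge lies on no other edge of the set. -/
lemma IsEdgeOpenPacking.exists_outer {B : Finset (Sym2 V)} (hB : G.IsEdgeOpenPacking B) :
    ∃ o : Sym2 V → V, (∀ e ∈ B, o e ∈ e) ∧ (∀ e ∈ B, ∀ e' ∈ B, o e ∈ e' → e = e') ∧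
      ∀ e ∈ B, ∀ e' ∈ B, ¬ G.Adj (o e) (o e') := by
  rw [isEdgeOpenPacking_iff] at hB
  have key : ∀ e ∈ B, ∃ v ∈ e, ∀ e' ∈ B, v ∈ e' → e = e' := by
    intro e he
    induction e with | _ u v
    -- If both ends of the edge met other edges `f` and `g` of `B`, the edge itself would join `f`
    -- to `g`.
    by_contra! hcon
    obtain ⟨f, hf, huf, hne⟩ := hcon u (by simp)
    obtain ⟨g, hg, hvg, hne'⟩ := hcon v (by simp)
    by_cases hfg : f = g
    · subst hfg
      exact hne ((Sym2.mem_and_mem_iff (hB.1 _ he).ne).1 ⟨huf, hvg⟩).symm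
    · rcases hB.2 f hf g hg hfg u huf v hvg (hB.1 _ he) with h | h
      · exact hne h
      · exact hne' h
  have : ∀ e, ∃ v, e ∈ B → v ∈ e ∧ ∀ e' ∈ B, v ∈ e' → e = e' := by
    intro e
    by_cases he : e ∈ B
    · obtain ⟨v, h₁, h₂⟩ := key e he
      exact ⟨v, fun _ => ⟨h₁, h₂⟩⟩
    · exact ⟨e.out.1, fun h => (he h).elim⟩
  choose o ho using this
  refine ⟨o, fun e he => (ho e he).1, fun e he => (ho e he).2, fun e he e' he' hadj => ?_⟩
  have hne : e ≠ e' := by rintro rfl; exact hadj.ne rfl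
  rcases hB.2 e he e' he' hne _ (ho e he).1 _ (ho e' he').1 hadj with h | h
  · exact hne.symm ((ho e' he').2 e he (h ▸ Sym2.mem_mk_right _ _))
  · exact hne ((ho e he).2 e' he' (h ▸ Sym2.mem_mk_left _ _))

/-- `par` and `dep` are the parent and depth functions of the tree `G` rooted at `r`. -/
structure IsRooting (G : SimpleGraph V) (r : V) (par : V → V) (dep : V → ℕ) : Prop where
  par_root : par r = r
  adj_par : ∀ u, u ≠ r → G.Adj u (par u)
  dep_eq : ∀ u, u ≠ r → dep u = dep (par u) + 1
  of_adj : ∀ u v, G.Adj u v → par u = v ∨ par v = u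

lemma IsTree.exists_isRooting (hG : G.IsTree) (r : V) : ∃ par dep, G.IsRooting r par dep := by
  choose p hp hp' using (hG.existsUnique_path · r)
  refine ⟨fun v => (p v).snd, fun v => (p v).length, ?_, ?_, ?_, ?_⟩
  · rw [← hp' r .nil .nil]; rfl
  · exact fun u hu => (p u).adj_snd (Walk.not_nil_of_ne hu)
  · intro u hu
    have hn := Walk.not_nil_of_ne (p := p u) hu
    change _ = (p (p u).snd).length + 1
    rw [← hp' _ (p u).tail (hp u).tail, Walk.length_tail_add_one hn]
  · intro u v h
    by_cases hv : v ∈ (p u).support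
    · exact .inl (hG.isAcyclic.eq_snd_of_adj_start (hp u) h hv).symm
    · right
      rw [← hp' v (.cons h.symm (p u)) ((hp u).cons hv)]
      simp

lemma IsRooting.par_ne {r : V} {par : V → V} {dep : V → ℕ} (h : G.IsRooting r par dep) {u v : V}
    (huv : G.Adj u v) (hu : par u = v) : par v ≠ u := by
  intro hv
  have hne := huv.ne
  have h₁ : u ≠ r := by rintro rfl; exact hne (h.par_root ▸ hu)
  have h₂ : v ≠ r := by rintro rfl; exact hne (h.par_root ▸ hv).symm
  have := h.dep_eq u h₁
  have := h.dep_eq v h₂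
  grind

end SimpleGraph

/-! ### The exchange argument in a rooted tree -/

namespace SimpleGraph

variable {V : Type*} {G : SimpleGraph V}

/-- `S` is the vertex set of an induced matching, which joins each `v ∈ S` to `σ v`. -/
structure IsPairing (G : SimpleGraph V) (S : Finset V) (σ : V → V) : Prop where
  mem : ∀ v ∈ S, σ v ∈ S
  adj : ∀ v ∈ S, G.Adj v (σ v)
  invol : ∀ v ∈ S, σ (σ v) = v
  eq : ∀ u ∈ S, ∀ v ∈ S, G.Adj u v → v = σ u

variable [DecidableEq V]

/-- The vertices of a pairing that lie below their partner in a rooted tree. -/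
def lowerEnds (S : Finset V) (σ par : V → V) : Finset V := {v ∈ S | par v = σ v}

lemma mem_lowerEnds {S : Finset V} {σ par : V → V} {v : V} :
    v ∈ lowerEnds S σ par ↔ v ∈ S ∧ par v = σ v := by simp [lowerEnds]

section Rooted

variable {r : V} {par : V → V} {dep : V → ℕ} {S : Finset V} {σ : V → V}

lemma IsRooting.ne_of_mem_lowerEnds (h : G.IsRooting r par dep) (hS : G.IsPairing S σ) {v : V}
    (hv : v ∈ lowerEnds S σ par) : par (σ v) ≠ v := by
  rw [mem_lowerEnds] at hv
  exact h.par_ne (hS.adj v hv.1) hv.2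

lemma IsRooting.not_mem_lowerEnds (h : G.IsRooting r par dep) (hS : G.IsPairing S σ) {v : V}
    (hv : v ∈ lowerEnds S σ par) : σ v ∉ lowerEnds S σ par := by
  intro h'
  have h₁ := h.ne_of_mem_lowerEnds hS hv
  rw [mem_lowerEnds] at hv h'
  exact h₁ (h'.2.trans (hS.invol v hv.1))

lemma IsRooting.mem_lowerEnds_or (h : G.IsRooting r par dep) (hS : G.IsPairing S σ) {v : V}
    (hv : v ∈ S) : v ∈ lowerEnds S σ par ∨ σ v ∈ lowerEnds S σ par := by
  rcases h.of_adj v (σ v) (hS.adj v hv) with h | h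
  · exact .inl (mem_lowerEnds.2 ⟨hv, h⟩)
  · exact .inr (mem_lowerEnds.2 ⟨hS.mem v hv, by rw [h, hS.invol v hv]⟩)

lemma IsRooting.lowerEnds_pair (h : G.IsRooting r par dep) (hS : G.IsPairing S σ) {i j : V}
    (hi : i ∈ lowerEnds S σ par) (hj : j ∈ lowerEnds S σ par) (hij : i ≠ j) (a : V)
    (ha : a = i ∨ a = σ i) (b : V) (hb : b = j ∨ b = σ j) : a ≠ b ∧ ¬ G.Adj a b := by
  have hi' := h.not_mem_lowerEnds hS hi
  have hj' := h.not_mem_lowerEnds hS hj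
  have hiS := (mem_lowerEnds.1 hi).1
  have hjS := (mem_lowerEnds.1 hj).1
  have e₁ := hS.invol i hiS
  have e₂ := hS.invol j hjS
  have haS : a ∈ S := by rcases ha with rfl | rfl <;> [exact hiS; exact hS.mem _ hiS]
  have hbS : b ∈ S := by rcases hb with rfl | rfl <;> [exact hjS; exact hS.mem _ hjS]
  have hne : σ i ≠ σ j := fun e => hij (by rw [← e₁, e, e₂])
  have hne₁ : i ≠ σ j := fun e => hj' (e ▸ hi)
  have hne₂ : σ i ≠ j := fun e => hi' (e ▸ hj)
  refine ⟨?_, fun hab => ?_⟩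
  · rcases ha with rfl | rfl <;> rcases hb with rfl | rfl <;> assumption
  · have e := hS.eq a haS b hbS hab
    rcases ha with rfl | rfl <;> rcases hb with rfl | rfl
    · exact hne₂ e.symm
    · exact hne e.symm
    · exact hij (e₁ ▸ e).symm
    · exact hne₁ (e₁ ▸ e).symm

variable [Finite V]

/-- The matching, with one edge per lower end, is traded for a larger packing: each c ∈ `A`
contributes the edge to `p c`, and only the matching edges at members of `N` outside the image of
`p` are lost, at most |N| - |A| < |A| of them. The set `N` need not consist of pendants, so the
lemma also applies to a single vertex without pendants. -/
lemma IsRooting.card_lowerEnds_lt_of_deficient (h : G.IsRooting r par dep)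
    (hS : G.IsPairing S σ) {A N : Finset V} {p : V → V} (hr : r ∈ A)
    (hAS : ∀ c ∈ A, c ∉ S) (hNS : N ⊆ S) (hNσ : ∀ m ∈ N, σ m ∉ N)
    (hA : ∀ c ∈ A, ∀ c' ∈ A, ¬ G.Adj c c')
    (hpar : ∀ w, w ∈ A ∨ w ∈ N → par w ∈ A ∨ par w ∈ N)
    (hpN : ∀ c ∈ A, p c ∈ N) (hp : ∀ c ∈ A, G.Adj c (p c))
    (hp' : ∀ c ∈ A, ∀ c' ∈ A, G.Adj c (p c') → c' = c)
    (hthrough : ∀ c ∈ A, ∀ z ∈ S, z ∉ N → G.Adj c z → ∃ d, d ≠ z ∧ G.Adj (σ z) d)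
    (hcard : N.card < 2 * A.card) :
    (lowerEnds S σ par).card < G.edgeOpenPackingNumber := by
  classical
  set X := lowerEnds S σ par with hX
  -- For these pairs the upper end is a child of some c ∈ `A`. Keeping the matching edge would put
  -- its star center next to the outer end c, so the edge is moved one step down, from `y` to a
  -- child `d y`.
  set Y : Finset V := {y ∈ X | par (σ y) ∈ A ∧ σ y ∉ N} with hY
  have hrS : r ∉ S := hAS r hr
  have hXS : ∀ v ∈ X, v ∈ S := fun v hv => (mem_lowerEnds.1 hv).1
  have hXpar : ∀ v ∈ X, par v = σ v := fun v hv => (mem_lowerEnds.1 hv).2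
  have hnr : ∀ v ∈ S, v ≠ r := fun v hv e => hrS (e ▸ hv)
  have hd : ∀ y, ∃ d, y ∈ Y → G.Adj y d ∧ par d = y ∧ d ∉ S ∧ d ∉ A := by
    intro y
    by_cases hy : y ∈ Y
    swap
    · exact ⟨y, fun h => (hy h).elim⟩
    simp only [hY, Finset.mem_filter] at hy
    obtain ⟨hyX, hyA, hyN⟩ := hy
    have hσS := hS.mem y (hXS y hyX)
    obtain ⟨d, hd, hyd⟩ := hthrough _ hyA (σ y) hσS hyN (h.adj_par _ (hnr _ hσS)).symm
    rw [hS.invol y (hXS y hyX)] at hyd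
    have hdpar : par d = y := by
      rcases h.of_adj _ _ hyd with e | e
      · exact (hd (e ▸ hXpar y hyX)).elim
      · exact e
    have hdS : d ∉ S := fun hdS => hd (hS.eq y (hXS y hyX) d hdS hyd)
    refine ⟨d, fun _ => ⟨hyd, hdpar, hdS, fun hdA => ?_⟩⟩
    have h₁ : y ∈ N := by
      rcases hpar d (.inl hdA) with e | e
      · exact (hAS _ e (hdpar ▸ hXS y hyX)).elim
      · exact hdpar ▸ e
    rcases hpar y (.inr h₁) with e | e
    · exact hAS _ e (hXpar y hyX ▸ hσS)
    · exact hyN (hXpar y hyX ▸ e)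
  choose d hd using hd
  set D : Finset V := Y.image d with hD
  -- After the move, `d y` may be adjacent to upper ends of further pairs. Such an upper end becomes
  -- an outer end in the star at `d y`. All other surviving pairs keep their edge, with the lower
  -- end outside; those with upper end `p c` share the star of c. Here `x` is the outer end and `κ`
  -- the star center.
  set drop : Finset V := {v ∈ X | σ v ∈ N ∧ σ v ∉ A.image p} with hdrop
  set x : V → V := fun v => if v ∈ A then v else if par (σ v) ∈ D then σ v else v with hx
  set κ : V → V := fun v => if v ∈ A then p v else if v ∈ Y then d v else
    if par (σ v) ∈ D then par (σ v) else σ v with hκ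
  have hpinj : Set.InjOn p (A : Set V) := fun c hc c' hc' e => (hp' c' hc' c hc (e ▸ hp c' hc'))
  have hdrop_card : drop.card + A.card ≤ N.card := by
    have h₁ : drop.card ≤ (N \ A.image p).card := by
      refine Finset.card_le_card_of_injOn σ ?_ ?_
      · intro v hv
        simp only [hdrop, Finset.coe_filter, Set.mem_ofPred_eq] at hv
        simpa using ⟨hv.2.1, by simpa using hv.2.2⟩
      · intro u hu v hv e
        simp only [hdrop, Finset.coe_filter, Set.mem_ofPred_eq] at hu hv
        rw [← hS.invol u (hXS u hu.1), e, hS.invol v (hXS v hv.1)]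
    have h₂ : A.image p ⊆ N := by
      intro v hv
      obtain ⟨c, hc, rfl⟩ := Finset.mem_image.1 hv
      exact hpN c hc
    have h₃ := Finset.card_sdiff_add_card_eq_card h₂
    rw [Finset.card_image_of_injOn hpinj] at h₃
    omega
  have hdisj : Disjoint (X \ drop) A := by
    rw [Finset.disjoint_left]
    intro v hv hvA
    exact hAS v hvA (hXS v (Finset.mem_sdiff.1 hv).1)
  have hcardI : X.card < ((X \ drop) ∪ A).card := by
    rw [Finset.card_union_of_disjoint hdisj]
    have hsub : drop ⊆ X := Finset.filter_subset _ _
    have := Finset.card_sdiff_add_card_eq_card hsub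
    omega
  have hYX : ∀ y ∈ Y, y ∈ X := fun y hy => (Finset.mem_filter.1 hy).1
  have hXN : ∀ v ∈ X, v ∉ N := by
    intro v hv hvN
    have hσ := hS.mem v (hXS v hv)
    rcases hpar v (.inr hvN) with e | e
    · exact hAS _ e (hXpar v hv ▸ hσ)
    · exact hNσ v hvN (hXpar v hv ▸ e)
  have hDY : ∀ w ∈ D, par w ∈ Y ∧ d (par w) = w ∧ w ∉ S ∧ w ∉ A := by
    intro w hw
    obtain ⟨y, hy, rfl⟩ := Finset.mem_image.1 hw
    obtain ⟨-, h₁, h₂, h₃⟩ := hd y hy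
    rw [h₁]
    exact ⟨hy, rfl, h₂, h₃⟩
  have hDN : ∀ w ∈ D, w ∉ N := fun w hw hN => (hDY w hw).2.2.1 (hNS hN)
  have hdD : ∀ y ∈ Y, d y ∈ D := fun y hy => Finset.mem_image_of_mem d hy
  have hW : ∀ u v, G.Adj u v → (v ∈ A ∨ v ∈ N) → u ∉ A → u ∉ N → par u = v := by
    intro u v huv hv huA huN
    rcases h.of_adj u v huv with e | e
    · exact e
    · have := hpar v hv
      rw [e] at this
      tauto
  have hXX : ∀ i ∈ X, ∀ j ∈ X, i ≠ j → ∀ a, (a = i ∨ a = σ i) → ∀ b, (b = j ∨ b = σ j) →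
      a ≠ b ∧ ¬ G.Adj a b := fun i hi j hj => h.lowerEnds_pair hS hi hj
  have hcases : ∀ i ∈ (X \ drop) ∪ A, (i ∈ A ∧ x i = i ∧ κ i = p i) ∨
      (i ∈ X ∧ i ∈ Y ∧ x i = i ∧ κ i = d i) ∨
      (i ∈ X ∧ par (σ i) ∈ D ∧ x i = σ i ∧ κ i = par (σ i)) ∨
      (i ∈ X ∧ i ∉ Y ∧ par (σ i) ∉ D ∧ x i = i ∧ κ i = σ i ∧ (σ i ∈ N → σ i ∈ A.image p)) := by
    intro i hi
    by_cases hiA : i ∈ A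
    · left; simp [hx, hκ, hiA]
    right
    obtain ⟨hiX, hid⟩ : i ∈ X ∧ i ∉ drop := by
      simpa [hiA] using hi
    by_cases hiY : i ∈ Y
    · left
      have hnD : par (σ i) ∉ D := fun hD' => (hDY _ hD').2.2.2 (Finset.mem_filter.1 hiY).2.1
      exact ⟨hiX, hiY, by simp only [hx, hiA, hnD, if_false], by simp only [hκ, hiA, hiY, if_false, if_true]⟩
    · right
      by_cases hiD : par (σ i) ∈ D
      · left
        exact ⟨hiX, hiD, by simp only [hx, hiA, hiD, if_false, if_true],
          by simp only [hκ, hiA, hiY, hiD, if_false, if_true]⟩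
      · right
        refine ⟨hiX, hiY, hiD, by simp only [hx, hiA, hiD, if_false],
          by simp only [hκ, hiA, hiY, hiD, if_false], fun hN => ?_⟩
        by_contra hcon
        exact hid (Finset.mem_filter.2 ⟨hiX, hN, hcon⟩)
  have hAX : ∀ c ∈ A, ∀ j ∈ X, ¬ G.Adj c j := by
    intro c hc j hj hcj
    have e := hW j c hcj.symm (.inl hc) (fun hjA => hAS j hjA (hXS j hj)) (hXN j hj)
    rw [hXpar j hj] at e
    exact hAS c hc (e ▸ hS.mem j (hXS j hj))
  have hAD : ∀ c ∈ A, ∀ j ∈ X, par (σ j) ∈ D → ¬ G.Adj c (σ j) := by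
    intro c hc j hj hjD hcj
    have hσ := hS.mem j (hXS j hj)
    by_cases hN : σ j ∈ N
    · rcases hpar _ (.inr hN) with e | e
      · exact (hDY _ hjD).2.2.2 e
      · exact hDN _ hjD e
    · have e := hW _ c hcj.symm (.inl hc) (fun hjA => hAS _ hjA hσ) hN
      exact (hDY _ hjD).2.2.2 (e ▸ hc)
  have hND : ∀ m ∈ N, ∀ w ∈ D, ¬ G.Adj m w := by
    intro m hm w hw hmw
    have e := hW w m hmw.symm (.inr hm) (hDY w hw).2.2.2 (hDN w hw)
    exact hXN _ (hYX _ (hDY w hw).1) (e ▸ hm)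
  have hDD : ∀ w ∈ D, ∀ w' ∈ D, ¬ G.Adj w w' := by
    intro w hw w' hw' hww
    rcases h.of_adj _ _ hww with e | e
    · exact (hDY w' hw').2.2.1 (e ▸ hXS _ (hYX _ (hDY w hw).1))
    · exact (hDY w hw).2.2.1 (e ▸ hXS _ (hYX _ (hDY w' hw').1))
  have hDS : ∀ w ∈ D, ∀ j ∈ X, G.Adj w (σ j) → par (σ j) = w := by
    intro w hw j hj hwj
    rcases h.of_adj _ _ hwj with e | e
    · exact (h.not_mem_lowerEnds hS hj (e ▸ hYX _ (hDY w hw).1)).elim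
    · exact e
  have hDX : ∀ w ∈ D, ∀ j ∈ X, G.Adj w j → j ∈ Y ∧ d j = w := by
    intro w hw j hj hwj
    rcases h.of_adj _ _ hwj with e | e
    · exact e ▸ ⟨(hDY w hw).1, (hDY w hw).2.1⟩
    · exact ((hDY w hw).2.2.1 (e ▸ hXpar j hj ▸ hS.mem j (hXS j hj))).elim
  have hAw : ∀ c ∈ A, ∀ w ∈ D, ¬ G.Adj c w := by
    intro c hc w hw hcw
    have e := hW w c hcw.symm (.inl hc) (hDY w hw).2.2.2 (hDN w hw)
    exact hAS c hc (e ▸ hXS _ (hYX _ (hDY w hw).1))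
  have hNσ' : ∀ m ∈ N, ∀ j ∈ X, ¬ G.Adj m (σ j) := by
    intro m hm j hj hmj
    have e := hS.eq _ (hS.mem j (hXS j hj)) m (hNS hm) hmj.symm
    rw [hS.invol j (hXS j hj)] at e
    exact hXN j hj (e ▸ hm)
  have hNN : ∀ m ∈ N, ∀ m' ∈ N, ¬ G.Adj m m' := fun m hm m' hm' hmm =>
    hNσ m hm (hS.eq m (hNS hm) m' (hNS hm') hmm ▸ hm')
  have hNX : ∀ m ∈ N, ∀ j ∈ X, G.Adj j m → m = σ j := fun m hm j hj hjm =>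
    hS.eq j (hXS j hj) m (hNS hm) hjm
  refine hcardI.trans_le (card_le_edgeOpenPackingNumber _ x κ ?_ ?_)
  · intro i hi
    rcases hcases i hi with ⟨h₁, e₁, e₂⟩ | ⟨h₁, h₂, e₁, e₂⟩ | ⟨h₁, h₂, e₁, e₂⟩ |
      ⟨h₁, h₂, h₃, e₁, e₂, -⟩ <;> rw [e₁, e₂]
    · exact hp i h₁
    · exact (hd i h₂).1
    · exact h.adj_par _ (hnr _ (hS.mem i (hXS i h₁)))
    · exact hS.adj i (hXS i h₁)
  · intro i hi j hj hij
    rcases hcases i hi with ⟨h₁, e₁, e₂⟩ | ⟨h₁, h₂, e₁, e₂⟩ | ⟨h₁, h₂, e₁, e₂⟩ |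
      ⟨h₁, h₂, h₃, e₁, e₂, h₄⟩ <;>
    rcases hcases j hj with ⟨k₁, f₁, f₂⟩ | ⟨k₁, k₂, f₁, f₂⟩ | ⟨k₁, k₂, f₁, f₂⟩ |
      ⟨k₁, k₂, k₃, f₁, f₂, k₄⟩ <;> rw [e₁, e₂, f₁, f₂]
    · exact ⟨hij, hA i h₁ j k₁, hNN _ (hpN i h₁) _ (hpN j k₁), fun e => by rw [hp' i h₁ j k₁ e]⟩
    · exact ⟨fun e => hAS i h₁ (e ▸ hXS j k₁), hAX i h₁ j k₁, hND _ (hpN i h₁) _ (hdD j k₂),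
        fun e => (hAw i h₁ _ (hdD j k₂) e).elim⟩
    · exact ⟨fun e => hAS i h₁ (e ▸ hS.mem j (hXS j k₁)), hAD i h₁ j k₁ k₂,
        hND _ (hpN i h₁) _ k₂, fun e => (hAw i h₁ _ k₂ e).elim⟩
    · refine ⟨fun e => hAS i h₁ (e ▸ hXS j k₁), hAX i h₁ j k₁, hNσ' _ (hpN i h₁) j k₁, fun e => ?_⟩
      -- A center adjacent to `i` is either a pendant kept because it is some `p c`, and then c =
      -- `i`, or lies outside `N`, which would place `j` in `Y`.
      by_cases hN : σ j ∈ N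
      · obtain ⟨c, hc, hcj⟩ := Finset.mem_image.1 (k₄ hN)
        rw [← hcj] at e ⊢
        rw [hp' i h₁ c hc e]
      · have e' := hW _ i e.symm (.inl h₁) (fun hjA => hAS _ hjA (hS.mem j (hXS j k₁))) hN
        exact (k₂ (Finset.mem_filter.2 ⟨k₁, e' ▸ h₁, hN⟩)).elim
    · exact ⟨fun e => hAS j k₁ (e ▸ hXS i h₁), fun e => hAX j k₁ i h₁ e.symm,
        fun e => hND _ (hpN j k₁) _ (hdD i h₂) e.symm, fun e =>
          ((Finset.mem_filter.1 h₂).2.2 (hNX _ (hpN j k₁) i h₁ e ▸ hpN j k₁)).elim⟩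
    · exact ⟨hij, (hXX i h₁ j k₁ hij _ (.inl rfl) _ (.inl rfl)).2, hDD _ (hdD i h₂) _ (hdD j k₂),
        fun e => (hDX _ (hdD j k₂) i h₁ e.symm).2⟩
    · have := hXX i h₁ j k₁ hij _ (.inl rfl) _ (.inr rfl)
      exact ⟨this.1, this.2, hDD _ (hdD i h₂) _ k₂, fun e => (hDX _ k₂ i h₁ e.symm).2⟩
    · exact ⟨hij, (hXX i h₁ j k₁ hij _ (.inl rfl) _ (.inl rfl)).2,
        fun e => k₃ (hDS _ (hdD i h₂) j k₁ e ▸ hdD i h₂),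
        fun e => ((hXX i h₁ j k₁ hij _ (.inl rfl) _ (.inr rfl)).2 e).elim⟩
    · refine ⟨fun e => hAS j k₁ (e ▸ hS.mem i (hXS i h₁)), fun e => hAD j k₁ i h₁ h₂ e.symm,
        fun e => hND _ (hpN j k₁) _ h₂ e.symm, fun e => (hNσ' _ (hpN j k₁) i h₁ e.symm).elim⟩
    · have := hXX i h₁ j k₁ hij _ (.inr rfl) _ (.inl rfl)
      exact ⟨this.1, this.2, hDD _ h₂ _ (hdD j k₂), fun e => hDS _ (hdD j k₂) i h₁ e.symm⟩
    · have := hXX i h₁ j k₁ hij _ (.inr rfl) _ (.inr rfl)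
      exact ⟨this.1, this.2, hDD _ h₂ _ k₂, fun e => hDS _ k₂ i h₁ e.symm⟩
    · have := hXX i h₁ j k₁ hij _ (.inr rfl) _ (.inl rfl)
      exact ⟨this.1, this.2, fun e => k₃ (hDS _ h₂ j k₁ e ▸ h₂),
        fun e => ((hXX i h₁ j k₁ hij _ (.inr rfl) _ (.inr rfl)).2 e).elim⟩
    · exact ⟨fun e => hAS j k₁ (e ▸ hXS i h₁), fun e => hAX j k₁ i h₁ e.symm,
        fun e => hNσ' _ (hpN j k₁) i h₁ e.symm, fun e => (hNX _ (hpN j k₁) i h₁ e).symm⟩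
    · exact ⟨hij, (hXX i h₁ j k₁ hij _ (.inl rfl) _ (.inl rfl)).2,
        fun e => h₃ (hDS _ (hdD j k₂) i h₁ e.symm ▸ hdD j k₂),
        fun e => (h₂ (hDX _ (hdD j k₂) i h₁ e.symm).1).elim⟩
    · have := hXX i h₁ j k₁ hij _ (.inl rfl) _ (.inr rfl)
      exact ⟨this.1, this.2, fun e => h₃ (hDS _ k₂ i h₁ e.symm ▸ k₂),
        fun e => (h₂ (hDX _ k₂ i h₁ e.symm).1).elim⟩
    · exact ⟨hij, (hXX i h₁ j k₁ hij _ (.inl rfl) _ (.inl rfl)).2,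
        (hXX i h₁ j k₁ hij _ (.inr rfl) _ (.inr rfl)).2,
        fun e => ((hXX i h₁ j k₁ hij _ (.inl rfl) _ (.inr rfl)).2 e).elim⟩

end Rooted

end SimpleGraph

/-! ### Pendants and Hall's condition -/

namespace SimpleGraph

variable {V : Type*} {G : SimpleGraph V} {S : Finset V} {σ : V → V}

open Classical in
/-- The matched neighbours of `c` whose partner is a leaf. -/
noncomputable def pendants (G : SimpleGraph V) (S : Finset V) (σ : V → V) (c : V) : Finset V :=
  {m ∈ S | G.Adj c m ∧ ∀ u, G.Adj (σ m) u → u = m}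

lemma mem_pendants {c m : V} :
    m ∈ pendants G S σ c ↔ m ∈ S ∧ G.Adj c m ∧ ∀ u, G.Adj (σ m) u → u = m := by
  simp [pendants]

variable [DecidableEq V]

lemma IsRooting.two_mul_card_lowerEnds {r : V} {par : V → V} {dep : V → ℕ}
    (h : G.IsRooting r par dep) (hS : G.IsPairing S σ) :
    2 * (lowerEnds S σ par).card = S.card := by
  set X := lowerEnds S σ par with hX
  have hXS : ∀ v ∈ X, v ∈ S := fun v hv => (mem_lowerEnds.1 hv).1
  have hinj : Set.InjOn σ (X : Set V) := fun u hu v hv e => by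
    rw [← hS.invol u (hXS u hu), e, hS.invol v (hXS v hv)]
  have hdisj : Disjoint X (X.image σ) := by
    rw [Finset.disjoint_left]
    intro v hv hv'
    obtain ⟨u, hu, rfl⟩ := Finset.mem_image.1 hv'
    exact h.not_mem_lowerEnds hS hu hv
  have hU : X ∪ X.image σ = S := by
    ext v
    simp only [Finset.mem_union, Finset.mem_image]
    constructor
    · rintro (hv | ⟨u, hu, rfl⟩)
      · exact hXS v hv
      · exact hS.mem u (hXS u hu)
    · intro hv
      exact (h.mem_lowerEnds_or hS hv).imp id fun hσ => ⟨σ v, hσ, hS.invol v hv⟩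
  rw [← hU, Finset.card_union_of_disjoint hdisj, Finset.card_image_of_injOn hinj]
  ring

section Finite

variable [Finite V]

/-- Otherwise take a neighbour r of `c` and add the edge from `c` to r. Each matching edge with an
end adjacent to r is replaced by an edge from such an end to r, joining the star at r; the rest
stay. This packing has one edge more than the matching. The rooting only selects one end of each
pair. -/
lemma exists_adj_mem_of_max (hG : G.IsTree) (hS : G.IsPairing S σ)
    (hmax : 2 * G.edgeOpenPackingNumber ≤ S.card) [Nontrivial V] {c : V} (hc : c ∉ S) :
    ∃ m ∈ S, G.Adj c m := by
  classical
  by_contra! hcS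
  obtain ⟨r, hcr⟩ := hG.connected.preconnected.exists_adj_of_nontrivial c
  obtain ⟨par, dep, h⟩ := hG.exists_isRooting c
  have hX2 := h.two_mul_card_lowerEnds hS
  set X := lowerEnds S σ par with hX
  have hXS : ∀ v ∈ X, v ∈ S := fun v hv => (mem_lowerEnds.1 hv).1
  have hcX : c ∉ X := fun e => hc (hXS c e)
  have key := card_le_edgeOpenPackingNumber (G := G) (insert c X)
    (fun v => if v = c then c else if G.Adj (σ v) r then σ v else v)
    (fun v => if v = c then r else if G.Adj (σ v) r ∨ G.Adj v r then r else σ v) ?_ ?_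
  · rw [Finset.card_insert_of_notMem hcX] at key
    omega
  · intro i hi
    rcases Finset.mem_insert.1 hi with rfl | hi
    · simpa using hcr
    · have hic : i ≠ c := fun e => hcX (e ▸ hi)
      by_cases h₁ : G.Adj (σ i) r
      · simp [hic, h₁]
      · by_cases h₂ : G.Adj i r
        · simp [hic, h₁, h₂]
        · simpa [hic, h₁, h₂] using hS.adj i (hXS i hi)
  · have htype : ∀ i ∈ X, ∃ a b, (a = i ∨ a = σ i) ∧
        (if i = c then c else if G.Adj (σ i) r then σ i else i) = a ∧
        (if i = c then r else if G.Adj (σ i) r ∨ G.Adj i r then r else σ i) = b ∧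
        (b = r ∨ b = σ i ∧ ¬ G.Adj (σ i) r ∧ ¬ G.Adj a r) := by
      intro i hi
      have hic : i ≠ c := fun e => hcX (e ▸ hi)
      by_cases h₁ : G.Adj (σ i) r
      · exact ⟨σ i, r, by simp [hic, h₁]⟩
      · by_cases h₂ : G.Adj i r
        · exact ⟨i, r, by simp [hic, h₁, h₂]⟩
        · exact ⟨i, σ i, by simp [hic, h₁, h₂]⟩
    have hmem : ∀ i ∈ X, ∀ a, (a = i ∨ a = σ i) → a ∈ S := by
      rintro i hi a (rfl | rfl)
      · exact hXS _ hi
      · exact hS.mem _ (hXS _ hi)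
    intro i hi j hj hij
    rcases Finset.mem_insert.1 hi with rfl | hi
    · rcases Finset.mem_insert.1 hj with rfl | hj
      · exact (hij rfl).elim
      obtain ⟨a, b, ha, e₁, e₂, hb⟩ := htype j hj
      have haS := hmem j hj a ha
      rw [e₁, e₂, if_pos rfl, if_pos rfl]
      refine ⟨fun e => hc (e ▸ haS), hcS a haS, ?_, ?_⟩
      · rcases hb with rfl | ⟨rfl, hb, -⟩
        · exact G.irrefl
        · exact fun e => hb e.symm
      · rcases hb with rfl | ⟨rfl, -, -⟩
        · exact fun _ => rfl
        · exact fun e => (hcS _ (hmem j hj _ (.inr rfl)) e).elim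
    · obtain ⟨a, b, ha, e₁, e₂, hb⟩ := htype i hi
      have haS := hmem i hi a ha
      rw [e₁, e₂]
      rcases Finset.mem_insert.1 hj with rfl | hj
      · rw [if_pos rfl, if_pos rfl]
        refine ⟨fun e => hc (e ▸ haS), fun e => hcS a haS e.symm, ?_, ?_⟩
        · rcases hb with rfl | ⟨rfl, hb, -⟩
          · exact G.irrefl
          · exact hb
        · rcases hb with rfl | ⟨rfl, -, hb⟩
          · exact fun _ => rfl
          · exact fun e => (hb e).elim
      · obtain ⟨a', b', ha', f₁, f₂, hb'⟩ := htype j hj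
        rw [f₁, f₂]
        have hp := h.lowerEnds_pair hS hi hj hij
        refine ⟨(hp a ha a' ha').1, (hp a ha a' ha').2, ?_, ?_⟩
        · rcases hb with rfl | ⟨rfl, hb, -⟩ <;> rcases hb' with rfl | ⟨rfl, hb', -⟩
          · exact G.irrefl
          · exact fun e => hb' e.symm
          · exact hb
          · exact (hp _ (.inr rfl) _ (.inr rfl)).2
        · rcases hb' with rfl | ⟨rfl, -, -⟩
          · rcases hb with rfl | ⟨rfl, -, hb⟩
            · exact fun _ => rfl
            · exact fun e => (hb e).elim
          · exact fun e => ((hp a ha _ (.inr rfl)).2 e).elim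

/-- Without pendants, the partner of every matched neighbour of `c` has a further neighbour, so the
exchange works for A = {c} and N = {m} with any matched neighbour m. -/
lemma pendants_nonempty_of_max (hG : G.IsTree) (hS : G.IsPairing S σ)
    (hmax : 2 * G.edgeOpenPackingNumber ≤ S.card) [Nontrivial V] {c : V} (hc : c ∉ S) :
    (pendants G S σ c).Nonempty := by
  by_contra hemp
  obtain ⟨m, hm, hcm⟩ := exists_adj_mem_of_max hG hS hmax hc
  obtain ⟨par, dep, h⟩ := hG.exists_isRooting c
  have hX2 := h.two_mul_card_lowerEnds hS
  have := h.card_lowerEnds_lt_of_deficient hS (A := {c}) (N := {m}) (p := fun _ => m)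
    (by simp) (by simpa using hc) (by simpa using hm)
    (by simpa using (hS.adj m hm).ne') (by simp) ?_ (by simp) (by simpa using hcm) (by simp) ?_
    (by simp)
  · omega
  · simp only [Finset.mem_singleton]
    rintro w (rfl | rfl)
    · exact .inl h.par_root
    · rcases h.of_adj _ _ hcm with e | e
      · exact (hcm.ne (h.par_root ▸ e)).elim
      · exact .inl e
  · simp only [Finset.mem_singleton]
    rintro _ rfl z hz - hcz
    by_contra! hcon
    exact hemp ⟨z, mem_pendants.2 ⟨hz, hcz, fun u hu => by_contra fun hne => hcon u hne hu⟩⟩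

/-- If the vertices outside a maximum pairing violated the Hall-type condition below, then a
minimal violator would be joined to its pendants by a subtree, and could be traded for a larger
edge open packing set. -/
lemma two_mul_card_le_card_biUnion_pendants (hG : G.IsTree) (hS : G.IsPairing S σ)
    (hmax : 2 * G.edgeOpenPackingNumber ≤ S.card) [Nontrivial V] (A : Finset V)
    (hA : ∀ c ∈ A, c ∉ S) : 2 * A.card ≤ (A.biUnion (pendants G S σ)).card := by
  classical
  induction A using Finset.strongInduction with | _ A ih
  by_contra! hlt
  set N := A.biUnion (pendants G S σ) with hN
  have hmemN : ∀ m, m ∈ N ↔ ∃ c ∈ A, m ∈ pendants G S σ c := fun m => Finset.mem_biUnion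
  have hNS : N ⊆ S := fun m hm => by
    obtain ⟨c, -, hc⟩ := (hmemN m).1 hm
    exact (mem_pendants.1 hc).1
  have hAN : ∀ c ∈ A, c ∉ N := fun c hc h => hA c hc (hNS h)
  set priv : V → Finset V := fun c => pendants G S σ c \ (A.erase c).biUnion (pendants G S σ)
    with hpriv
  -- Minimality: `A` without `c` satisfies the Hall condition, which bounds the number of private
  -- pendants of `c`.
  have hle : ∀ c ∈ A, (priv c).card + 2 * A.card ≤ N.card + 2 := by
    intro c hc
    have h₁ := ih (A.erase c) (Finset.erase_ssubset hc) fun c' hc' =>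
      hA c' (Finset.mem_of_mem_erase hc')
    have h₂ : (priv c ∪ (A.erase c).biUnion (pendants G S σ)).card =
        (priv c).card + ((A.erase c).biUnion (pendants G S σ)).card :=
      Finset.card_union_of_disjoint Finset.sdiff_disjoint
    have h₃ : priv c ∪ (A.erase c).biUnion (pendants G S σ) = N := by
      rw [hpriv, Finset.sdiff_union_self_eq_union, ← Finset.biUnion_insert, Finset.insert_erase hc]
    rw [h₃] at h₂
    rw [Finset.card_erase_of_mem hc] at h₁
    omega
  obtain ⟨r, hr⟩ : A.Nonempty := by
    rw [Finset.nonempty_iff_ne_empty]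
    rintro rfl
    simp at hlt
  obtain ⟨par, dep, h⟩ := hG.exists_isRooting r
  set P := A.biUnion priv with hP
  set I : Finset (V × V) := {q ∈ A ×ˢ N | q.2 ∈ pendants G S σ q.1} with hI
  -- A pendant in `N` has at least two incidences with `A`, unless it is private and has one.
  have hI_lower : 2 * N.card ≤ I.card + P.card := by
    have h₁ : I.card = ∑ m ∈ N, (I.filter fun q => q.2 = m).card :=
      Finset.card_eq_sum_card_fiberwise fun q hq => by
        simp only [hI, Finset.coe_filter, Set.mem_ofPred_eq, Finset.mem_product] at hq
        exact hq.1.2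
    have h₂ : ∀ m ∈ N, 2 ≤ (I.filter fun q => q.2 = m).card + if m ∈ P then 1 else 0 := by
      intro m hm
      obtain ⟨c, hc, hcm⟩ := (hmemN m).1 hm
      have hmem : ∀ c ∈ A, m ∈ pendants G S σ c → (c, m) ∈ I.filter fun q => q.2 = m :=
        fun c hc hcm => by simp [hI, hc, hm, hcm]
      split_ifs with hmP
      · have := Finset.card_pos.2 ⟨_, hmem c hc hcm⟩
        omega
      · have : m ∉ priv c := fun e => hmP (Finset.mem_biUnion.2 ⟨c, hc, e⟩)
        simp only [hpriv, Finset.mem_sdiff, hcm, true_and, not_not, Finset.mem_biUnion] at this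
        obtain ⟨c', hc', hcm'⟩ := this
        rw [Finset.mem_erase] at hc'
        exact Finset.one_lt_card.2 ⟨_, hmem c hc hcm, _, hmem c' hc'.2 hcm', by
          simpa using hc'.1.symm⟩
    have h₃ := Finset.sum_le_sum h₂
    rw [Finset.sum_add_distrib, ← h₁, Finset.sum_const, smul_eq_mul, ← Finset.card_filter] at h₃
    have h₄ : (N.filter (· ∈ P)).card ≤ P.card :=
      Finset.card_le_card fun m hm => (Finset.mem_filter.1 hm).2
    omega
  set Z : Finset V := {w ∈ (A ∪ N).erase r | w ∈ A ∧ par w ∈ N ∨ w ∈ N ∧ par w ∈ A} with hZ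
  -- Each incidence is an edge of the tree, hence determined by its lower end; so there are at most
  -- |A| + |N| - 1 of them.
  have hIZ : I.card ≤ Z.card := by
    refine Finset.card_le_card_of_injOn (fun q => if par q.2 = q.1 then q.2 else q.1) ?_ ?_
    · rintro ⟨c, m⟩ hq
      simp only [hI, Finset.coe_filter, Set.mem_ofPred_eq, Finset.mem_product] at hq
      obtain ⟨⟨hc, hm⟩, hcm⟩ := hq
      have hmr : m ≠ r := fun e => hAN r hr (e ▸ hm)
      simp only [hZ, Finset.coe_filter, Set.mem_ofPred_eq, Finset.mem_erase, Finset.mem_union]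
      split_ifs with e
      · exact ⟨⟨hmr, .inr hm⟩, .inr ⟨hm, e ▸ hc⟩⟩
      · have e' := (h.of_adj _ _ (mem_pendants.1 hcm).2.1).resolve_right e
        refine ⟨⟨?_, .inl hc⟩, .inl ⟨hc, e' ▸ hm⟩⟩
        rintro rfl
        exact hmr (e' ▸ h.par_root)
    · rintro ⟨c, m⟩ hq ⟨c', m'⟩ hq' heq
      simp only [hI, Finset.coe_filter, Set.mem_ofPred_eq, Finset.mem_product] at hq hq'
      have o := h.of_adj _ _ (mem_pendants.1 hq.2).2.1
      have o' := h.of_adj _ _ (mem_pendants.1 hq'.2).2.1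
      have a₁ := hAN c hq.1.1
      have a₂ := hAN c' hq'.1.1
      have a₃ := hq.1.2
      have a₄ := hq'.1.2
      dsimp only at heq
      grind
  have hWcard : ((A ∪ N).erase r).card + 1 = A.card + N.card := by
    rw [Finset.card_erase_add_one (Finset.mem_union_left _ hr), Finset.card_union_of_disjoint
      (Finset.disjoint_left.2 hAN)]
  have hZW : Z ⊆ (A ∪ N).erase r := Finset.filter_subset _ _
  have hZcard := Finset.card_le_card hZW
  have hPsum : P.card ≤ ∑ c ∈ A, (priv c).card := Finset.card_biUnion_le
  have hNpos : 0 < N.card := by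
    obtain ⟨m, hm⟩ := pendants_nonempty_of_max hG hS hmax (hA r hr)
    exact Finset.card_pos.2 ⟨m, (hmemN m).2 ⟨r, hr, hm⟩⟩
  -- Otherwise `hle` leaves no private pendants and forces |N| = 2|A| - 2. The double count then
  -- gives |N| + 1 ≤ |A|, so |A| = 1 and `N` is empty.
  have hNcard : N.card + 1 = 2 * A.card := by
    by_contra hne
    have h₁ : ∑ c ∈ A, (priv c).card = 0 :=
      Finset.sum_eq_zero fun c hc => by have := hle c hc; omega
    have := hle r hr
    omega
  have hsum : ∑ c ∈ A, (priv c).card ≤ A.card :=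
    (Finset.sum_le_card_nsmul A _ 1 fun c hc => by have := hle c hc; omega).trans (by simp)
  -- With at most one private pendant per vertex of `A`, the double count is tight: every nonroot
  -- vertex of A ∪ N has its parent in the other class, and every c has a private pendant.
  have hZeq : Z = (A ∪ N).erase r := Finset.eq_of_subset_of_card_le hZW (by omega)
  have hpriv_ne : ∀ c ∈ A, (priv c).Nonempty := by
    intro c hc
    by_contra hemp
    rw [Finset.not_nonempty_iff_eq_empty] at hemp
    have : ∑ c ∈ A, (priv c).card < ∑ c ∈ A, 1 :=
      Finset.sum_lt_sum (fun c hc => by have := hle c hc; omega) ⟨c, hc, by simp [hemp]⟩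
    rw [Finset.sum_const, smul_eq_mul, mul_one] at this
    omega
  have hpar : ∀ w, w ∈ A ∨ w ∈ N → w ≠ r → w ∈ A ∧ par w ∈ N ∨ w ∈ N ∧ par w ∈ A := by
    intro w hw hwr
    have : w ∈ Z := by rw [hZeq]; simpa [hwr] using hw
    exact (Finset.mem_filter.1 this).2
  have hAindep : ∀ c ∈ A, ∀ c' ∈ A, par c = c' → ¬ G.Adj c c' := by
    intro c hc c' hc' e hcc
    have hcr : c ≠ r := by
      rintro rfl
      exact hcc.ne (h.par_root ▸ e)
    rcases hpar c (.inl hc) hcr with ⟨-, h'⟩ | ⟨h', -⟩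
    · exact hAN c' hc' (e ▸ h')
    · exact hAN c hc h'
  have hex : ∀ c, ∃ m, c ∈ A → m ∈ priv c := by
    intro c
    by_cases hc : c ∈ A
    · obtain ⟨m, hm⟩ := hpriv_ne c hc
      exact ⟨m, fun _ => hm⟩
    · exact ⟨c, fun h => (hc h).elim⟩
  choose p hp using hex
  have hp₁ : ∀ c ∈ A, p c ∈ pendants G S σ c := fun c hc => (Finset.mem_sdiff.1 (hp c hc)).1
  have hX2 := h.two_mul_card_lowerEnds hS
  have := h.card_lowerEnds_lt_of_deficient hS (A := A) (N := N) (p := p) hr hA hNS ?_ ?_ ?_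
    (fun c hc => (hmemN _).2 ⟨c, hc, hp₁ c hc⟩)
    (fun c hc => (mem_pendants.1 (hp₁ c hc)).2.1) ?_ ?_ hlt
  · omega
  · intro m hm hσ
    obtain ⟨c, -, hc⟩ := (hmemN m).1 hm
    obtain ⟨c', hc', hcσ⟩ := (hmemN _).1 hσ
    have := (mem_pendants.1 hc).2.2 c' (mem_pendants.1 hcσ).2.1.symm
    exact hA c' hc' (this ▸ hNS hm)
  · intro c hc c' hc' hcc
    rcases h.of_adj _ _ hcc with e | e
    · exact hAindep c hc c' hc' e hcc
    · exact hAindep c' hc' c hc e hcc.symm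
  · intro w hw
    by_cases hwr : w = r
    · rw [hwr, h.par_root]; exact .inl hr
    · exact (hpar w hw hwr).elim (fun h => .inr h.2) (fun h => .inl h.2)
  · intro c hc c' hc' hadj
    by_contra hne
    have h₁ := mem_pendants.1 (hp₁ c' hc')
    exact (Finset.mem_sdiff.1 (hp c' hc')).2 (Finset.mem_biUnion.2
      ⟨c, Finset.mem_erase.2 ⟨Ne.symm hne, hc⟩, mem_pendants.2 ⟨h₁.1, hadj, h₁.2.2⟩⟩)
  · intro c hc z hz hzN hcz
    by_contra! hcon
    exact hzN ((hmemN z).2 ⟨c, hc, mem_pendants.2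
      ⟨hz, hcz, fun u hu => by_contra fun hne => hcon u hne hu⟩⟩)

/-- Hall's theorem: each vertex outside a maximum pairing has two pendants of its own. -/
lemma exists_injective_pendants (hG : G.IsTree) (hS : G.IsPairing S σ)
    (hmax : 2 * G.edgeOpenPackingNumber ≤ S.card) [Nontrivial V] :
    ∃ f : {c // c ∉ S} × Bool → V, Function.Injective f ∧
      ∀ q, f q ∈ pendants G S σ q.1 := by
  classical
  rw [← Finset.all_card_le_biUnion_card_iff_exists_injective
    (fun q : {c // c ∉ S} × Bool => pendants G S σ q.1)]
  intro s
  have h₁ := two_mul_card_le_card_biUnion_pendants hG hS hmax (s.image fun q => (q.1 : V))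
    (by simp only [Finset.mem_image]; rintro _ ⟨q, -, rfl⟩; exact q.1.2)
  rw [Finset.image_biUnion] at h₁
  -- Each vertex outside `S` occurs with two Boolean labels, which accounts for the factor 2 in the
  -- Hall condition.
  have h₂ : s.card ≤ 2 * (s.image fun q => (q.1 : V)).card := by
    have : s ⊆ (s.image fun q => q.1) ×ˢ Finset.univ := fun q hq =>
      Finset.mem_product.2 ⟨Finset.mem_image_of_mem _ hq, Finset.mem_univ _⟩
    have h₃ := Finset.card_le_card this
    rw [Finset.card_product, Finset.card_univ, Fintype.card_bool] at h₃
    have h₄ : (s.image fun q => (q.1 : V)) = (s.image fun q => q.1).image Subtype.val := by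
      rw [Finset.image_image]; rfl
    rw [h₄, Finset.card_image_of_injective _ Subtype.val_injective]
    omega
  exact h₂.trans h₁

end Finite

end SimpleGraph

/-! ### Adjacency and edge count in disjoint unions of spiders -/

instance SpiderVertex.instFinite (k : ℕ) : Finite (SpiderVertex k) :=
  Finite.of_surjective
    (fun x : Option (Fin k ⊕ Fin k) => match x with
      | none => SpiderVertex.center
      | some (.inl j) => .mid j
      | some (.inr j) => .leaf j)
    fun x => match x with
      | .center => ⟨none, rfl⟩
      | .mid j => ⟨some (.inl j), rfl⟩
      | .leaf j => ⟨some (.inr j), rfl⟩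

/-- The neighbour of a spider vertex towards the center. -/
def SpiderVertex.up {k : ℕ} : SpiderVertex k → SpiderVertex k
  | .center => .center
  | .mid _ => .center
  | .leaf j => .mid j

/-- The distance of a spider vertex to the center. -/
def SpiderVertex.rank {k : ℕ} : SpiderVertex k → ℕ
  | .center => 0
  | .mid _ => 1
  | .leaf _ => 2

lemma SpiderVertex.rank_up {k : ℕ} {a : SpiderVertex k} (ha : a ≠ .center) :
    a.up.rank + 1 = a.rank := by
  cases a <;> simp_all [up, rank]

lemma spider_adj_iff {k : ℕ} {a b : SpiderVertex k} :
    (spider k).Adj a b ↔ a ≠ .center ∧ a.up = b ∨ b ≠ .center ∧ b.up = a := by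
  rw [spider, SimpleGraph.fromRel_adj]
  cases a <;> cases b <;> simp [SpiderVertex.up, eq_comm]

lemma spiderUnion_adj_iff {n : ℕ} {k : Fin n → ℕ} {x y : Σ i : Fin n, SpiderVertex (k i)} :
    (spiderUnion k).Adj x y ↔
      x.2 ≠ .center ∧ ⟨x.1, x.2.up⟩ = y ∨ y.2 ≠ .center ∧ ⟨y.1, y.2.up⟩ = x := by
  rw [spiderUnion, SimpleGraph.fromRel_adj]
  constructor
  · rintro ⟨-, ⟨i, a, b, hab, rfl, rfl⟩ | ⟨i, a, b, hab, rfl, rfl⟩⟩ <;>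
      rcases spider_adj_iff.1 hab with ⟨h, rfl⟩ | ⟨h, rfl⟩ <;> simp [h]
  · rintro (⟨h, rfl⟩ | ⟨h, rfl⟩)
    · have hadj := spider_adj_iff.2 (.inl ⟨h, rfl⟩)
      refine ⟨fun e => hadj.ne ?_, .inl ⟨_, _, _, hadj, rfl, rfl⟩⟩
      exact eq_of_heq (Sigma.mk.inj e).2
    · have hadj := spider_adj_iff.2 (.inl ⟨h, rfl⟩)
      refine ⟨fun e => hadj.ne ?_, .inr ⟨_, _, _, hadj, rfl, rfl⟩⟩
      exact (eq_of_heq (Sigma.mk.inj e).2).symm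

/-- Each vertex other than a center corresponds to the edge leading from it towards its center;
`rank` rules out that two vertices give the same edge. -/
lemma ncard_edgeSet_spiderUnion {n : ℕ} (k : Fin n → ℕ) :
    (spiderUnion k).edgeSet.ncard + n = Nat.card (Σ i : Fin n, SpiderVertex (k i)) := by
  set C : Set (Σ i : Fin n, SpiderVertex (k i)) := {x | x.2 = .center} with hC
  have hCcard : C.ncard = n := by
    have : C = Set.range fun i : Fin n =>
        (⟨i, .center⟩ : Σ i : Fin n, SpiderVertex (k i)) := by
      ext ⟨i, a⟩
      constructor
      · intro h
        exact ⟨i, by simp only [show a = .center from h]⟩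
      · rintro ⟨j, h⟩
        cases h
        rfl
    rw [this, ← Set.image_univ, Set.ncard_image_of_injective, Set.ncard_univ, Nat.card_fin]
    intro i j h
    exact (Sigma.mk.inj h).1
  have hE : (spiderUnion k).edgeSet = (fun x => s(x, ⟨x.1, x.2.up⟩)) '' Cᶜ := by
    ext e
    induction e with | _ x y
    simp only [SimpleGraph.mem_edgeSet, spiderUnion_adj_iff, Set.mem_image]
    constructor
    · rintro (⟨h, rfl⟩ | ⟨h, rfl⟩)
      · exact ⟨x, h, rfl⟩
      · exact ⟨y, h, Sym2.eq_swap⟩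
    · rintro ⟨z, hz, e⟩
      rcases Sym2.eq_iff.1 e with ⟨rfl, h⟩ | ⟨rfl, h⟩
      · exact .inl ⟨hz, h⟩
      · exact .inr ⟨hz, h⟩
  have hinj : Set.InjOn (fun x : Σ i : Fin n, SpiderVertex (k i) =>
      s(x, (⟨x.1, x.2.up⟩ : Σ i : Fin n, SpiderVertex (k i)))) Cᶜ := by
    intro x hx y hy e
    rcases Sym2.eq_iff.1 e with h | ⟨h₁, h₂⟩
    · exact h.1
    · have e₁ : x.2.rank = y.2.up.rank := by rw [h₁]
      have e₂ : x.2.up.rank = y.2.rank := by rw [← h₂]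
      have := SpiderVertex.rank_up hx
      have := SpiderVertex.rank_up hy
      omega
  have := Set.ncard_compl_add_ncard C
  rwa [hCcard, ← hinj.ncard_image, ← hE] at this

/-! ### Assembling a tree from spiders -/

namespace SimpleGraph

variable {V : Type*} {T : SimpleGraph V}

/-- The number of added edges need not be assumed: a tree has one edge fewer than vertices, the
spider union has n fewer, so n - 1 edges are added. -/
lemma IsTree.isInSpiderFamily_of_equiv [Finite V] (hT : T.IsTree) {n : ℕ} {k : Fin n → ℕ}
    (Φ : (Σ i : Fin n, SpiderVertex (k i)) ≃ V) (hk : ∀ i, 2 ≤ k i)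
    (hle : ∀ x y, (spiderUnion k).Adj x y → T.Adj (Φ x) (Φ y))
    (hadj : ∀ x y, T.Adj (Φ x) (Φ y) → x.2 = .center ∨ y.2 = .center ∨ (spiderUnion k).Adj x y)
    (hleaf : ∀ i, ∃ j₁ j₂ : Fin (k i), j₁ ≠ j₂ ∧
      (∀ u, T.Adj (Φ ⟨i, .leaf j₁⟩) u → u = Φ ⟨i, .mid j₁⟩) ∧
      ∀ u, T.Adj (Φ ⟨i, .leaf j₂⟩) u → u = Φ ⟨i, .mid j₂⟩) :
    T.IsInSpiderFamily := by
  have iso : T.comap Φ ≃g T := Iso.comap Φ T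
  have hH : (T.comap Φ).IsTree := iso.isTree_iff.2 hT
  have hfin : ((T.comap Φ).edgeSet \ (spiderUnion k).edgeSet).Finite := Set.toFinite _
  have hle' : spiderUnion k ≤ T.comap Φ := fun x y h => hle x y h
  refine ⟨n, k, hfin.toFinset, T.comap Φ, hk, ?_, ?_, ?_, hH, ?_, ?_, ⟨iso.symm⟩⟩
  · intro e he
    rw [Set.Finite.mem_toFinset] at he
    exact ⟨not_isDiag_of_mem_edgeSet _ he.1, he.2⟩
  · rw [← Set.ncard_eq_toFinset_card _ hfin, Set.ncard_sdiff (edgeSet_mono hle')]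
    have h₁ := (isTree_iff_connected_and_card.1 hH).2
    have h₂ := ncard_edgeSet_spiderUnion k
    have h₃ := Set.ncard_le_ncard (edgeSet_mono hle') (Set.toFinite _)
    rw [Nat.card_coe_set_eq] at h₁
    omega
  · ext x y
    simp only [sup_adj, fromEdgeSet_adj, Set.Finite.coe_toFinset, Set.mem_sdiff, mem_edgeSet]
    constructor
    · intro h
      by_cases h' : (spiderUnion k).Adj x y
      · exact .inl h'
      · exact .inr ⟨⟨h, h'⟩, h.ne⟩
    · rintro (h | h)
      · exact hle' h
      · exact h.1.1
  · intro e he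
    rw [Set.Finite.mem_toFinset] at he
    induction e with | _ x y
    obtain ⟨i, a⟩ := x
    obtain ⟨j, b⟩ := y
    rcases hadj _ _ he.1 with h | h | h
    · exact ⟨i, Sym2.mem_iff.2 (.inl (by rw [← show a = .center from h]))⟩
    · exact ⟨j, Sym2.mem_iff.2 (.inr (by rw [← show b = .center from h]))⟩
    · exact (he.2 h).elim
  · intro i
    obtain ⟨j₁, j₂, hne, h₁, h₂⟩ := hleaf i
    have key : ∀ j, (∀ u, T.Adj (Φ ⟨i, .leaf j⟩) u → u = Φ ⟨i, .mid j⟩) →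
        ((T.comap Φ).neighborSet ⟨i, .leaf j⟩).ncard = 1 := by
      intro j hj
      rw [Set.ncard_eq_one]
      refine ⟨⟨i, .mid j⟩, ?_⟩
      ext x
      simp only [mem_neighborSet, comap_adj, Set.mem_singleton_iff]
      constructor
      · exact fun h => Φ.injective (hj _ h)
      · rintro rfl
        exact hle _ _ (spiderUnion_adj_iff.2 (.inl ⟨by simp, rfl⟩))
    exact ⟨j₁, j₂, hne, key _ h₁, key _ h₂⟩

variable [DecidableEq V] {S : Finset V} {σ : V → V} {r : V} {par : V → V} {dep : V → ℕ}

lemma IsTree.isInSpiderFamily_of_pendants [Finite V] (hT : T.IsTree) (hS : T.IsPairing S σ)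
    (h : T.IsRooting r par dep) (hr : r ∉ S) (f : {c // c ∉ S} × Bool → V)
    (hf : Function.Injective f) (hfp : ∀ q, f q ∈ pendants T S σ q.1) :
    T.IsInSpiderFamily := by
  classical
  have hXS : ∀ v ∈ lowerEnds S σ par, v ∈ S := fun v hv => (mem_lowerEnds.1 hv).1
  -- Every matching edge chooses a center `c` and the end `m` attached to it. A pair hit by `f` must
  -- follow `f`, which hits it only once: if both ends were chosen, the owner of one would be a
  -- neighbour of a leaf, hence equal to the other end, which is in `S`.
  have hex : ∀ v : {v // v ∈ lowerEnds S σ par}, ∃ (m : V) (c : {c // c ∉ S}),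
      (m = v ∨ m = σ v) ∧ T.Adj c m ∧
      ∀ q, f q = v ∨ f q = σ v → m = f q ∧ c = q.1 := by
    rintro ⟨v, hv⟩
    have hvS := hXS v hv
    have hinv := hS.invol v hvS
    by_cases hq : ∃ q, f q = v ∨ f q = σ v
    · obtain ⟨q, hq⟩ := hq
      refine ⟨f q, q.1, hq, (mem_pendants.1 (hfp q)).2.1, fun q' hq' => ?_⟩
      have : f q = f q' := by
        by_contra hne
        have : f q' = σ (f q) := by
          rcases hq with e | e <;> rcases hq' with e' | e' <;> simp_all
        have h₁ := (mem_pendants.1 (hfp q)).2.2 q'.1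
          (this ▸ (mem_pendants.1 (hfp q')).2.1.symm)
        exact q'.1.2 (h₁ ▸ (mem_pendants.1 (hfp q)).1)
      rw [hf this]
      exact ⟨rfl, rfl⟩
    -- An unclaimed pair hangs by its upper end from that end's parent, which lies outside `S`
    -- because the matching is induced.
    · have hσS := hS.mem v hvS
      have hadj := h.adj_par (σ v) fun e => hr (e ▸ hσS)
      refine ⟨σ v, ⟨par (σ v), fun hc => ?_⟩, .inr rfl, hadj.symm, fun q h' => (hq ⟨q, h'⟩).elim⟩
      exact h.ne_of_mem_lowerEnds hS hv ((hS.eq _ hσS _ hc hadj).trans hinv)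
  choose mid own hmid hown hq using hex
  have hmidS : ∀ v, mid v ∈ S := fun v => by
    rcases hmid v with e | e <;> rw [e]
    · exact hXS _ v.2
    · exact hS.mem _ (hXS _ v.2)
  have hσmid : ∀ v, σ (mid v) = v ∨ σ (mid v) = σ v := fun v => by
    rcases hmid v with e | e <;> rw [e]
    · exact .inr rfl
    · exact .inl (hS.invol _ (hXS _ v.2))
  have hσmidS : ∀ v, σ (mid v) ∈ S := fun v => hS.mem _ (hmidS v)
  have huniq : ∀ v w : {v // v ∈ lowerEnds S σ par}, ∀ a b, (a = (v : V) ∨ a = σ v) →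
      (b = (w : V) ∨ b = σ w) → a = b → v = w := by
    intro v w a b ha hb hab
    by_contra hne
    exact (h.lowerEnds_pair hS v.2 w.2 (fun e => hne (Subtype.ext e)) a ha b hb).1 hab
  obtain ⟨n, ⟨e⟩⟩ := Finite.exists_equiv_fin {c // c ∉ S}
  set k : Fin n → ℕ := fun i => Nat.card {v // own v = e.symm i} with hk
  have ε : ∀ i, Fin (k i) ≃ {v // own v = e.symm i} := fun i => (Finite.equivFin _).symm
  set φ : (Σ i : Fin n, SpiderVertex (k i)) → V := fun x => match x with
    | ⟨i, .center⟩ => e.symm i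
    | ⟨i, .mid j⟩ => mid (ε i j)
    | ⟨i, .leaf j⟩ => σ (mid (ε i j)) with hφ
  have hεinj : ∀ i j i' j', ((ε i j : {v // own v = e.symm i}) : {v // v ∈ lowerEnds S σ par}) =
      ε i' j' → (⟨i, j⟩ : Σ i, Fin (k i)) = ⟨i', j'⟩ := by
    intro i j i' j' heq
    have : i = i' := e.symm.injective (by rw [← (ε i j).2, heq, (ε i' j').2])
    subst this
    rw [(ε i).injective (Subtype.ext heq)]
  have hεsurj : ∀ v, ∃ i j, ((ε i j : {v // own v = e.symm i}) :
      {v // v ∈ lowerEnds S σ par}) = v := fun v =>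
    ⟨e (own v), (ε _).symm ⟨v, by simp⟩, by rw [Equiv.apply_symm_apply]⟩
  have hbij : Function.Bijective φ := by
    constructor
    · rintro ⟨i, _ | j | j⟩ ⟨i', _ | j' | j'⟩ heq <;> simp only [hφ] at heq
      · rw [e.symm.injective (Subtype.ext heq)]
      · exact ((e.symm i).2 (heq ▸ hmidS _)).elim
      · exact ((e.symm i).2 (heq ▸ hσmidS _)).elim
      · exact ((e.symm i').2 (heq ▸ hmidS _)).elim
      · cases hεinj _ _ _ _ (huniq _ _ _ _ (hmid _) (hmid _) heq); rfl
      · cases hεinj _ _ _ _ (huniq _ _ _ _ (hmid _) (hσmid _) heq)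
        exact ((hS.adj _ (hmidS _)).ne heq).elim
      · exact ((e.symm i').2 (heq ▸ hσmidS _)).elim
      · cases hεinj _ _ _ _ (huniq _ _ _ _ (hσmid _) (hmid _) heq)
        exact ((hS.adj _ (hmidS _)).ne heq.symm).elim
      · cases hεinj _ _ _ _ (huniq _ _ _ _ (hσmid _) (hσmid _) heq); rfl
    · intro u
      by_cases hu : u ∈ S
      · obtain ⟨v, hv⟩ : ∃ v : {v // v ∈ lowerEnds S σ par}, u = v ∨ u = σ v := by
          rcases h.mem_lowerEnds_or hS hu with h' | h'
          · exact ⟨⟨u, h'⟩, .inl rfl⟩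
          · exact ⟨⟨_, h'⟩, .inr (hS.invol u hu).symm⟩
        have hinv := hS.invol v (hXS _ v.2)
        have : u = mid v ∨ u = σ (mid v) := by
          rcases hmid v with h₁ | h₁ <;> rcases hv with h₂ | h₂ <;> rw [h₁, h₂]
          · exact .inl rfl
          · exact .inr rfl
          · exact .inr hinv.symm
          · exact .inl rfl
        obtain ⟨i, j, rfl⟩ := hεsurj v
        rcases this with h' | h'
        · exact ⟨⟨i, .mid j⟩, h'.symm⟩
        · exact ⟨⟨i, .leaf j⟩, h'.symm⟩
      · exact ⟨⟨e ⟨u, hu⟩, .center⟩, by simp [hφ]⟩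
  have hpend : ∀ i, ∃ j₁ j₂ : Fin (k i), j₁ ≠ j₂ ∧
      (∀ u, T.Adj (φ ⟨i, .leaf j₁⟩) u → u = φ ⟨i, .mid j₁⟩) ∧
      ∀ u, T.Adj (φ ⟨i, .leaf j₂⟩) u → u = φ ⟨i, .mid j₂⟩ := by
    intro i
    have hj : ∀ b, ∃ j : Fin (k i), mid (ε i j) = f (e.symm i, b) := by
      intro b
      have hb := (mem_pendants.1 (hfp (e.symm i, b))).1
      obtain ⟨v, hv⟩ : ∃ v : {v // v ∈ lowerEnds S σ par},
          f (e.symm i, b) = v ∨ f (e.symm i, b) = σ v := by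
        rcases h.mem_lowerEnds_or hS hb with h' | h'
        · exact ⟨⟨_, h'⟩, .inl rfl⟩
        · exact ⟨⟨_, h'⟩, .inr (hS.invol _ hb).symm⟩
      obtain ⟨h₁, h₂⟩ := hq v _ hv
      exact ⟨(ε i).symm ⟨v, h₂⟩, by rw [Equiv.apply_symm_apply]; exact h₁⟩
    choose j hj using hj
    have hl : ∀ b u, T.Adj (φ ⟨i, .leaf (j b)⟩) u → u = φ ⟨i, .mid (j b)⟩ := by
      intro b u hu
      simp only [hφ, hj] at hu ⊢
      exact (mem_pendants.1 (hfp (e.symm i, b))).2.2 u hu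
    refine ⟨j true, j false, fun h' => ?_, hl _, hl _⟩
    have := (hj true).symm.trans ((congrArg (fun a => mid (ε i a)) h').trans (hj false))
    simpa using hf this
  refine hT.isInSpiderFamily_of_equiv (Equiv.ofBijective φ hbij) ?_ ?_ ?_ hpend
  · intro i
    obtain ⟨j₁, j₂, hne, -⟩ := hpend i
    have := Fintype.one_lt_card_iff.2 ⟨j₁, j₂, hne⟩
    rwa [Fintype.card_fin] at this
  · have key : ∀ x : Σ i : Fin n, SpiderVertex (k i), x.2 ≠ .center →
        T.Adj (φ x) (φ ⟨x.1, x.2.up⟩) := by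
      rintro ⟨i, _ | j | j⟩ hx
      · exact (hx rfl).elim
      · have := hown (ε i j)
        rw [(ε i j).2] at this
        exact this.symm
      · exact (hS.adj _ (hmidS _)).symm
    intro x y hxy
    rcases spiderUnion_adj_iff.1 hxy with ⟨h₁, rfl⟩ | ⟨h₁, rfl⟩
    · exact key x h₁
    · exact (key y h₁).symm
  · rintro ⟨i, _ | j | j⟩ y hxy
    · exact .inl rfl
    · by_cases hy : y.2 = .center
      · exact .inr (.inl hy)
      have hyS : φ y ∈ S := by
        obtain ⟨i', _ | j' | j'⟩ := y
        exacts [(hy rfl).elim, hmidS _, hσmidS _]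
      have e₁ : φ y = φ ⟨i, .leaf j⟩ := hS.eq _ (hmidS _) _ hyS hxy
      obtain rfl : y = ⟨i, .leaf j⟩ := hbij.1 e₁
      exact .inr (.inr (spiderUnion_adj_iff.2 (.inr ⟨by simp, rfl⟩)))
    · by_cases hy : y.2 = .center
      · exact .inr (.inl hy)
      have hyS : φ y ∈ S := by
        obtain ⟨i', _ | j' | j'⟩ := y
        exacts [(hy rfl).elim, hmidS _, hσmidS _]
      have e₁ : φ y = φ ⟨i, .mid j⟩ :=
        (hS.eq _ (hσmidS _) _ hyS hxy).trans (hS.invol _ (hmidS _))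
      obtain rfl : y = ⟨i, .mid j⟩ := hbij.1 e₁
      exact .inr (.inr (spiderUnion_adj_iff.2 (.inl ⟨by simp, rfl⟩)))

end SimpleGraph

/-! ### Trees of the spider family attain equality -/

namespace SimpleGraph

section Iso

variable {V W : Type*} {G : SimpleGraph V} {H : SimpleGraph W}

lemma Iso.isEdgeOpenPacking_map (f : G ≃g H) {B : Finset (Sym2 V)} (hB : G.IsEdgeOpenPacking B) :
    H.IsEdgeOpenPacking (B.map f.toEquiv.toEmbedding.sym2Map) := by
  rw [isEdgeOpenPacking_iff] at hB ⊢
  refine ⟨?_, ?_⟩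
  · simp only [Finset.mem_map]
    rintro _ ⟨e, he, rfl⟩
    induction e with | _ u v
    exact f.map_adj_iff.2 (hB.1 _ he)
  · simp only [Finset.mem_map]
    rintro _ ⟨e₁, h₁, rfl⟩ _ ⟨e₂, h₂, rfl⟩ hne a ha b hb hab
    obtain ⟨a, ha', rfl⟩ := Sym2.mem_map.1 ha
    obtain ⟨b, hb', rfl⟩ := Sym2.mem_map.1 hb
    rcases hB.2 e₁ h₁ e₂ h₂ (fun e => hne (e ▸ rfl)) a ha' b hb' (f.map_adj_iff.1 hab) with h | h
    · left; rw [← h]; rfl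
    · right; rw [← h]; rfl

lemma Iso.isInducedMatching_map (f : G ≃g H) {M : Finset (Sym2 V)} (hM : G.IsInducedMatching M) :
    H.IsInducedMatching (M.map f.toEquiv.toEmbedding.sym2Map) := by
  refine ⟨?_, ?_⟩
  · simp only [Finset.mem_map]
    rintro _ ⟨e, he, rfl⟩
    have := hM.1 _ he
    induction e with | _ u v
    exact f.map_adj_iff.2 this
  · simp only [Finset.mem_map]
    rintro _ ⟨e₁, h₁, rfl⟩ _ ⟨e₂, h₂, rfl⟩ hne a ha b hb
    obtain ⟨a, ha', rfl⟩ := Sym2.mem_map.1 ha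
    obtain ⟨b, hb', rfl⟩ := Sym2.mem_map.1 hb
    obtain ⟨h, h'⟩ := hM.2 e₁ h₁ e₂ h₂ (fun e => hne (e ▸ rfl)) a ha' b hb'
    exact ⟨fun e => h (f.injective e), fun e => h' (f.map_adj_iff.1 e)⟩

lemma Iso.edgeOpenPackingNumber_le [Finite V] [Finite W] (f : G ≃g H) :
    G.edgeOpenPackingNumber ≤ H.edgeOpenPackingNumber := by
  obtain ⟨B, hB, h⟩ := G.exists_isEdgeOpenPacking_card_eq
  rw [← h, ← Finset.card_map f.toEquiv.toEmbedding.sym2Map]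
  exact (f.isEdgeOpenPacking_map hB).card_le

lemma Iso.inducedMatchingNumber_le [Finite V] [Finite W] (f : G ≃g H) :
    G.inducedMatchingNumber ≤ H.inducedMatchingNumber := by
  obtain ⟨B, hB, h⟩ := G.exists_isInducedMatching_card_eq
  rw [← h, ← Finset.card_map f.toEquiv.toEmbedding.sym2Map]
  exact (f.isInducedMatching_map hB).card_le

end Iso

section Spiders

variable {n : ℕ} {k : Fin n → ℕ} {H : SimpleGraph (Σ i : Fin n, SpiderVertex (k i))}

lemma sum_le_inducedMatchingNumber (hle : spiderUnion k ≤ H)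
    (hadj : ∀ x y, H.Adj x y → x.2 = .center ∨ y.2 = .center ∨ (spiderUnion k).Adj x y) :
    Fintype.card (Σ i, Fin (k i)) ≤ H.inducedMatchingNumber := by
  classical
  set g : (Σ i, Fin (k i)) → Sym2 (Σ i : Fin n, SpiderVertex (k i)) :=
    fun q => s(⟨q.1, .mid q.2⟩, ⟨q.1, .leaf q.2⟩) with hg
  have hmem : ∀ q a, a ∈ g q → a.2 ≠ .center ∧
      (a = ⟨q.1, .mid q.2⟩ ∨ a = ⟨q.1, .leaf q.2⟩) := by
    intro q a ha
    have := Sym2.mem_iff.1 ha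
    exact ⟨by rcases this with rfl | rfl <;> simp, this⟩
  have hsame : ∀ q q' a b, a ∈ g q → b ∈ g q' → a = b ∨ (spiderUnion k).Adj a b → q = q' := by
    rintro ⟨i, j⟩ ⟨i', j'⟩ a b ha hb hab
    simp only [spiderUnion_adj_iff] at hab
    rcases (hmem _ _ ha).2 with rfl | rfl <;> rcases (hmem _ _ hb).2 with rfl | rfl <;>
      · simp only [SpiderVertex.up, Sigma.mk.injEq] at hab
        rcases hab with ⟨rfl, h⟩ | ⟨-, ⟨rfl, h⟩⟩ | ⟨-, ⟨rfl, h⟩⟩ <;> simp_all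
  have hinj : Function.Injective g := fun q q' e =>
    hsame q q' _ _ (Sym2.mem_mk_left _ _) (e ▸ Sym2.mem_mk_left _ _) (.inl rfl)
  rw [← Finset.card_univ, ← Finset.card_image_of_injective _ hinj]
  refine IsInducedMatching.card_le ⟨?_, ?_⟩
  · simp only [Finset.mem_image]
    rintro _ ⟨q, -, rfl⟩
    exact hle (spiderUnion_adj_iff.2 (.inr ⟨by simp, rfl⟩))
  · simp only [Finset.mem_image]
    rintro _ ⟨q, -, rfl⟩ _ ⟨q', -, rfl⟩ hne a ha b hb
    refine ⟨fun e => hne (by rw [hsame q q' a b ha hb (.inl e)]), fun e => ?_⟩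
    rcases hadj a b e with h | h | h
    · exact (hmem _ _ ha).1 h
    · exact (hmem _ _ hb).1 h
    · exact hne (by rw [hsame q q' a b ha hb (.inr h)])

lemma edgeOpenPackingNumber_le_sum (hle : spiderUnion k ≤ H)
    (hleaf : ∀ i, ∃ j₁ j₂ : Fin (k i), j₁ ≠ j₂ ∧
      (∀ u, H.Adj ⟨i, .leaf j₁⟩ u → u = ⟨i, .mid j₁⟩) ∧
      ∀ u, H.Adj ⟨i, .leaf j₂⟩ u → u = ⟨i, .mid j₂⟩) :
    H.edgeOpenPackingNumber ≤ Fintype.card (Σ i, Fin (k i)) := by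
  classical
  obtain ⟨B, hB, hcard⟩ := H.exists_isEdgeOpenPacking_card_eq
  obtain ⟨o, ho, hinj, hind⟩ := hB.exists_outer
  rw [isEdgeOpenPacking_iff] at hB
  have hcm : ∀ i (j : Fin (k i)), H.Adj ⟨i, .center⟩ ⟨i, .mid j⟩ := fun i j =>
    hle (spiderUnion_adj_iff.2 (.inr ⟨by simp, rfl⟩))
  have hml : ∀ i (j : Fin (k i)), H.Adj ⟨i, .mid j⟩ ⟨i, .leaf j⟩ := fun i j =>
    hle (spiderUnion_adj_iff.2 (.inr ⟨by simp, rfl⟩))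
  -- A leg free of outer ends, available whenever the center is an outer end. Its mids are then
  -- excluded by adjacency. If a pendant leaf is an outer end, the edge from center to mid joins the
  -- two packing edges, so it is the center's own packing edge; this can happen for only one of the
  -- two pendant legs.
  have hfree : ∀ i, ∃ j : Fin (k i), ∀ e ∈ B, o e = ⟨i, .center⟩ →
      ∀ e' ∈ B, o e' ≠ ⟨i, .mid j⟩ ∧ o e' ≠ ⟨i, .leaf j⟩ := by
    intro i
    have hmid : ∀ e ∈ B, o e = ⟨i, .center⟩ → ∀ e' ∈ B, ∀ j, o e' ≠ ⟨i, .mid j⟩ := by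
      intro e he hoe e' he' j h
      exact hind e he e' he' (hoe ▸ h ▸ hcm i j)
    have key : ∀ e ∈ B, o e = ⟨i, .center⟩ → ∀ j : Fin (k i),
        (∀ u, H.Adj ⟨i, .leaf j⟩ u → u = ⟨i, .mid j⟩) → ∀ e' ∈ B, o e' = ⟨i, .leaf j⟩ →
        e = s(⟨i, .center⟩, ⟨i, .mid j⟩) := by
      intro e he hoe j hj e' he' hoe'
      have hme : (⟨i, .center⟩ : Σ i, SpiderVertex (k i)) ∈ e := hoe ▸ ho e he
      have hme' : (⟨i, .leaf j⟩ : Σ i, SpiderVertex (k i)) ∈ e' := hoe' ▸ ho e' he'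
      obtain ⟨u, rfl⟩ := hme'
      have hu := hj u (hB.1 _ he')
      subst hu
      have hne : e ≠ s(⟨i, .leaf j⟩, ⟨i, .mid j⟩) := by
        rintro rfl
        simp at hme
      rcases hB.2 e he _ he' hne _ hme _ (Sym2.mem_mk_right _ _) (hcm i j) with h | h
      · exact h.symm
      · simp at h
    obtain ⟨j₁, j₂, hne, h₁, h₂⟩ := hleaf i
    by_cases hc : ∃ e ∈ B, o e = ⟨i, .center⟩
    swap
    · exact ⟨j₁, fun e he hoe => (hc ⟨e, he, hoe⟩).elim⟩
    obtain ⟨e, he, hoe⟩ := hc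
    by_cases hl : ∃ e' ∈ B, o e' = ⟨i, .leaf j₁⟩
    · obtain ⟨e', he', hoe'⟩ := hl
      refine ⟨j₂, fun f hf hof f' hf' => ⟨hmid f hf hof f' hf' j₂, fun hof' => hne ?_⟩⟩
      have := (key e he hoe j₁ h₁ e' he' hoe').symm.trans (key e he hoe j₂ h₂ f' hf' hof')
      simpa using this
    · exact ⟨j₁, fun f hf hof f' hf' => ⟨hmid f hf hof f' hf' j₁, fun h => hl ⟨f', hf', h⟩⟩⟩
  choose free hfree using hfree
  set leg : (Σ i : Fin n, SpiderVertex (k i)) → Σ i, Fin (k i) := fun x => match x with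
    | ⟨i, .center⟩ => ⟨i, free i⟩
    | ⟨i, .mid j⟩ => ⟨i, j⟩
    | ⟨i, .leaf j⟩ => ⟨i, j⟩ with hleg
  rw [← hcard, ← Finset.card_univ]
  refine Finset.card_le_card_of_injOn (fun e => leg (o e)) (fun _ _ => Finset.mem_univ _) ?_
  intro e he e' he' heq
  suffices h : o e = o e' from hinj e he e' he' (h ▸ ho e' he')
  have hind' := hind e he e' he'
  have h₁ := fun i => hfree i e he
  have h₂ := fun i => hfree i e' he'
  have h₁ := fun i h => h₁ i h e' he'
  have h₂ := fun i h => h₂ i h e he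
  dsimp only at heq
  generalize o e = x at *
  generalize o e' = y at *
  clear he he'
  obtain ⟨i, _ | j | j⟩ := x <;> obtain ⟨i', _ | j' | j'⟩ := y <;>
    simp only [hleg] at heq <;> cases heq
  · rfl
  · exact ((h₁ _ rfl).1 rfl).elim
  · exact ((h₁ _ rfl).2 rfl).elim
  · exact ((h₂ _ rfl).1 rfl).elim
  · rfl
  · exact (hind' (hml _ _)).elim
  · exact ((h₂ _ rfl).2 rfl).elim
  · exact (hind' (hml _ _).symm).elim
  · rfl

end Spiders

variable {V : Type*} {T : SimpleGraph V}

lemma IsInSpiderFamily.edgeOpenPackingNumber_eq [Finite V] (hT : T.IsInSpiderFamily) :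
    T.edgeOpenPackingNumber = T.inducedMatchingNumber := by
  obtain ⟨n, k, E, H, -, -, -, hH, -, hE, hleaf, ⟨f⟩⟩ := hT
  have hle : spiderUnion k ≤ H := hH ▸ le_sup_left
  refine le_antisymm ?_ T.inducedMatchingNumber_le_edgeOpenPackingNumber
  refine (f.edgeOpenPackingNumber_le.trans (edgeOpenPackingNumber_le_sum hle ?_)).trans
    ((sum_le_inducedMatchingNumber hle ?_).trans f.symm.inducedMatchingNumber_le)
  · intro i
    obtain ⟨j₁, j₂, hne, h₁, h₂⟩ := hleaf i
    have key : ∀ j, (H.neighborSet ⟨i, .leaf j⟩).ncard = 1 →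
        ∀ u, H.Adj ⟨i, .leaf j⟩ u → u = ⟨i, .mid j⟩ := by
      intro j hj u hu
      obtain ⟨w, hw⟩ := Set.ncard_eq_one.1 hj
      have hm : (⟨i, .mid j⟩ : Σ i, SpiderVertex (k i)) ∈ H.neighborSet ⟨i, .leaf j⟩ :=
        hle (spiderUnion_adj_iff.2 (.inl ⟨by simp, rfl⟩))
      have hu : u ∈ H.neighborSet ⟨i, .leaf j⟩ := hu
      rw [hw] at hm hu
      exact hu.trans hm.symm
    exact ⟨j₁, j₂, hne, key _ h₁, key _ h₂⟩
  · intro x y hxy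
    rw [hH, sup_adj, fromEdgeSet_adj] at hxy
    rcases hxy with h | ⟨h, -⟩
    · exact .inr (.inr h)
    · obtain ⟨i, hi⟩ := hE _ h
      rcases Sym2.mem_iff.1 hi with rfl | rfl
      · exact .inl rfl
      · exact .inr (.inl rfl)

/-! ### Small trees, pairings and the conclusion -/

lemma edgeSet_subsingleton_of_equiv {m : ℕ} (hm : m ≤ 2) (f : V ≃ Fin m) :
    T.edgeSet.Subsingleton := by
  intro e he e' he'
  induction e with | _ a b
  induction e' with | _ c d
  have h₁ : f a ≠ f b := fun e => ((mem_edgeSet T).1 he).ne (f.injective e)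
  have h₂ : f c ≠ f d := fun e => ((mem_edgeSet T).1 he').ne (f.injective e)
  rw [Sym2.eq_iff, ← f.apply_eq_iff_eq, ← f.apply_eq_iff_eq, ← f.apply_eq_iff_eq,
    ← f.apply_eq_iff_eq]
  simp only [ne_eq, Fin.ext_iff] at *
  have := (f a).2
  have := (f b).2
  have := (f c).2
  have := (f d).2
  omega

lemma IsInducedMatching.exists_isPairing [DecidableEq V] {M : Finset (Sym2 V)}
    (hM : T.IsInducedMatching M) : ∃ S σ, T.IsPairing S σ ∧ S.card = 2 * M.card := by
  set S := M.biUnion Sym2.toFinset with hS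
  have hmem : ∀ v, v ∈ S ↔ ∃ e ∈ M, v ∈ e := by simp [hS]
  have hex : ∀ v, ∃ w, v ∈ S → s(v, w) ∈ M := by
    intro v
    by_cases hv : v ∈ S
    · obtain ⟨e, he, w, rfl⟩ := (hmem v).1 hv
      exact ⟨w, fun _ => he⟩
    · exact ⟨v, fun h => (hv h).elim⟩
  choose σ hσ using hex
  have heq : ∀ e ∈ M, ∀ e' ∈ M, ∀ a ∈ e, ∀ b ∈ e', a = b ∨ T.Adj a b → e = e' := by
    intro e he e' he' a ha b hb hab
    by_contra hne
    have := hM.2 e he e' he' hne a ha b hb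
    tauto
  have hσS : ∀ v ∈ S, σ v ∈ S := fun v hv =>
    (hmem _).2 ⟨_, hσ v hv, Sym2.mem_mk_right _ _⟩
  refine ⟨S, σ, ⟨hσS, fun v hv => hM.1 _ (hσ v hv), fun v hv => ?_, fun u hu v hv huv => ?_⟩, ?_⟩
  · have := heq _ (hσ v hv) _ (hσ _ (hσS v hv)) (σ v) (Sym2.mem_mk_right _ _) (σ v)
      (Sym2.mem_mk_left _ _) (.inl rfl)
    rw [Sym2.eq_swap] at this
    exact (Sym2.congr_right.1 this).symm
  · have := heq _ (hσ u hu) _ (hσ v hv) u (Sym2.mem_mk_left _ _) v (Sym2.mem_mk_left _ _)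
      (.inr huv)
    rcases Sym2.mem_iff.1 (this ▸ Sym2.mem_mk_left v (σ v)) with h | h
    · exact (huv.ne h.symm).elim
    · exact h
  · rw [hS, Finset.card_biUnion, Finset.sum_congr rfl (fun e he =>
      Sym2.card_toFinset_of_not_isDiag e (not_isDiag_of_mem_edgeSet _ (hM.1 e he))),
      Finset.sum_const, smul_eq_mul, mul_comm]
    intro e he e' he' hne
    refine Finset.disjoint_left.2 fun v hv hv' => ?_
    exact hne (heq e he e' he' v (Sym2.mem_toFinset.1 hv) v (Sym2.mem_toFinset.1 hv') (.inl rfl))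

/-- The partner is the only neighbour of each vertex, so by induction on depth no path from `v`
leaves the pair. -/
lemma IsTree.eq_or_eq_of_isPairing_univ (hT : T.IsTree) [Fintype V] {σ : V → V}
    (hσ : T.IsPairing Finset.univ σ) (v u : V) : u = v ∨ u = σ v := by
  obtain ⟨par, dep, h⟩ := hT.exists_isRooting v
  induction hn : dep u generalizing u with
  | zero =>
    left
    by_contra hu
    have := h.dep_eq u hu
    omega
  | succ m ih =>
    by_cases hu : u = v
    · exact .inl hu
    have h₁ := h.dep_eq u hu
    have h₂ := hσ.eq _ (Finset.mem_univ _) _ (Finset.mem_univ _) (h.adj_par u hu).symm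
    rcases ih (par u) (by omega) with e | e
    · exact .inr (h₂.trans (by rw [e]))
    · exact .inl (h₂.trans (by rw [e, hσ.invol _ (Finset.mem_univ _)]))

lemma nonempty_iso_top_of_card {m : ℕ} [Finite V] (hT : T = ⊤) {H : SimpleGraph (Fin m)}
    (hH : H = ⊤) (hcard : Nat.card V = m) : Nonempty (T ≃g H) := by
  subst hT hH
  exact ⟨Iso.completeGraph (Finite.equivFinOfCardEq hcard)⟩

end SimpleGraph

theorem mainTheorem1 {V : Type*} [Finite V] (T : SimpleGraph V) (hT : T.IsTree) :
    T.edgeOpenPackingNumber = T.inducedMatchingNumber ↔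
      T.IsInSpiderFamily ∨ Nonempty (T ≃g SimpleGraph.pathGraph 1) ∨
        Nonempty (T ≃g SimpleGraph.pathGraph 2) := by
  classical
  constructor
  · intro heq
    have hne := hT.connected.nonempty
    rcases subsingleton_or_nontrivial V with hV | hV
    · exact .inr (.inl (SimpleGraph.nonempty_iso_top_of_card (Subsingleton.elim _ _)
        (Subsingleton.elim _ _) (Nat.card_eq_one_iff_unique.2 ⟨hV, hne⟩)))
    obtain ⟨M, hM, hMcard⟩ := T.exists_isInducedMatching_card_eq
    obtain ⟨S, σ, hS, hScard⟩ := hM.exists_isPairing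
    -- A vertex outside `S` is needed as root, so that every matched vertex has a proper parent. If
    -- there is none, the tree is a single edge.
    by_cases hr : ∃ r, r ∉ S
    · obtain ⟨r, hr⟩ := hr
      obtain ⟨par, dep, h⟩ := hT.exists_isRooting r
      obtain ⟨f, hf, hfp⟩ := SimpleGraph.exists_injective_pendants hT hS (by omega)
      exact .inl (hT.isInSpiderFamily_of_pendants hS h hr f hf hfp)
    · push Not at hr
      have := Fintype.ofFinite V
      obtain rfl : S = Finset.univ := Finset.eq_univ_iff_forall.2 hr
      obtain ⟨v⟩ := hne
      have hall := hT.eq_or_eq_of_isPairing_univ hS v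
      have hadj := hS.adj v (Finset.mem_univ v)
      refine .inr (.inr (SimpleGraph.nonempty_iso_top_of_card ?_
        SimpleGraph.pathGraph_two_eq_top ?_))
      · ext a b
        rw [SimpleGraph.top_adj]
        refine ⟨SimpleGraph.Adj.ne, fun hab => ?_⟩
        rcases hall a with rfl | rfl <;> rcases hall b with rfl | rfl
        exacts [(hab rfl).elim, hadj, hadj.symm, (hab rfl).elim]
      · exact Nat.card_eq_two_iff.2 ⟨v, σ v, hadj.ne, Set.eq_univ_of_forall hall⟩
  · rintro (h | ⟨⟨f⟩⟩ | ⟨⟨f⟩⟩)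
    · exact h.edgeOpenPackingNumber_eq
    · exact SimpleGraph.edgeOpenPackingNumber_eq_of_subsingleton
        (SimpleGraph.edgeSet_subsingleton_of_equiv (by norm_num) f.toEquiv)
    · exact SimpleGraph.edgeOpenPackingNumber_eq_of_subsingleton
        (SimpleGraph.edgeSet_subsingleton_of_equiv le_rfl f.toEquiv)
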